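/- Let $\mathscr{O}$ be a discrete valuation ring with fraction field $\mathscr{K}$ and residue field $\mathbb{K}$ of characteristic different from $2$. Let $\mathcal{A}=\mathcal{A}_{\bar 0}\oplus\mathcal{A}_{\bar 1}$ be an $\mathscr{O}$-superalgebra (a $\mathbb{Z}/2$-graded associative unital $\mathscr{O}$-algebra) which is free of finite rank as an $\mathscr{O}$-module, and put $\mathscr{K}\mathcal{A}=\mathscr{K}\otimes_{\mathscr{O}}\mathcal{A}$, $\mathbb{K}\mathcal{A}=\mathbb{K}\otimes_{\mathscr{O}}\mathcal{A}$. Modules over a superalgebra are $\mathbb{Z}/2$-graded left modules. A homomorphism $f$ of such modules is a sum of homogeneous (even or odd) linear maps with $f(av)=(-1)^{|f||a|}af(v)$ for homogeneous $a$; in particular, isomorphisms may be odd. A module is simple if it is non-zero and has no graded submodules other than $0$ and itself. A simple module is of type $\texttt{M}$ (resp. type $\texttt{Q}$) if its algebra of all even and odd endomorphisms has dimension $1$ (resp. $2$) over the ground field. ${\rm Irr}$ denotes the set of isomorphism classes of simple modules. A finite-dimensional superalgebra over a field is split if each of its simple modules remains simple under every field extension, and it is semisimple if its usual (ungraded) Jacobson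 radical is $0$. Every simple $\mathscr{K}\mathcal{A}$-module $V$ contains a $\mathbb{Z}/2$-graded $\mathcal{A}$-submodule $\tilde V$ which is free of finite rank over $\mathscr{O}$ and satisfies $\mathscr{K}\otimes_{\mathscr{O}}\tilde V\cong V$. Fix any choice of such a $\tilde V$ for each $V$, and put $\mathbb{K}\tilde V=\mathbb{K}\otimes_{\mathscr{O}}\tilde V$. **Theorem 2.20.** Suppose that $\mathbb{K}\mathcal{A}$ and $\mathscr{K}\mathcal{A}$ are split and that $\mathbb{K}\mathcal{A}$ is semisimple. (1) If all simple $\mathscr{K}\mathcal{A}$-modules are of type $\texttt{M}$, then $V\mapsto\mathbb{K}\tilde V$ is a well-defined bijection ${\rm Irr}(\mathscr{K}\mathcal{A})\to{\rm Irr}(\mathbb{K}\mathcal{A})$, and all simple $\mathbb{K}\mathcal{A}$-modules are of type $\texttt{M}$. (2) If $\mathscr{O}$ is complete, then $V\mapsto\mathbb{K}\tilde V$ is a well-defined bijection ${\rm Irr}(\mathscr{K}\mathcal{A})\to{\rm Irr}(\mathbb{K}\mathcal{A})$ which sends simple modules of type $\texttt{M}$ to simple modules of type $\texttt{M}$ and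 simple modules of type $\texttt{Q}$ to simple modules of type $\texttt{Q}$. -/

import Mathlib

open scoped TensorProduct

universe u v w w₁ w₂ w₃ u'

noncomputable section

/-- A supermodule over the `R`-superalgebra `A = 𝒜 0 ⊕ 𝒜 1`: a left `A`-module together with a
`ℤ/2`-grading by `R`-submodules such that `A_i V_j ⊆ V_{i+j}`. -/
structure SuperModule {R : Type u} {A : Type v} [CommRing R] [Ring A] [Algebra R A]
    (𝒜 : ZMod 2 → Submodule R A) where
  carrier : Type w
  [addCommGroup : AddCommGroup carrier]
  [moduleBase : Module R carrier]
  [moduleAlg : Module A carrier]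
  [isScalarTower : IsScalarTower R A carrier]
  grading : ZMod 2 → Submodule R carrier
  isInternal : DirectSum.IsInternal grading
  smul_mem : ∀ {i j : ZMod 2} {a : A} {x : carrier},
    a ∈ 𝒜 i → x ∈ grading j → a • x ∈ grading (i + j)

namespace SuperModule

attribute [instance] SuperModule.addCommGroup SuperModule.moduleBase SuperModule.moduleAlg
  SuperModule.isScalarTower

section Basic

variable {R : Type u} {A : Type v} [CommRing R] [Ring A] [Algebra R A]
  {𝒜 : ZMod 2 → Submodule R A}

/-- The homogeneous homomorphisms `f : V → W` of parity `p`: those `R`-linear maps which send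
`V_i` to `W_{i+p}` and satisfy `f (a x) = (-1)^{p |a|} a (f x)` for homogeneous `a`. -/
def homOfParity (V : SuperModule.{u, v, w₁} 𝒜) (W : SuperModule.{u, v, w₂} 𝒜) (p : ZMod 2) :
    Submodule R (V.carrier →ₗ[R] W.carrier) where
  carrier := {f | (∀ i : ZMod 2, ∀ x ∈ V.grading i, f x ∈ W.grading (i + p)) ∧
    ∀ i : ZMod 2, ∀ a ∈ 𝒜 i, ∀ x : V.carrier, f (a • x) = ((-1 : ℤˣ) ^ (p * i)) • (a • f x)}
  zero_mem' := by
    refine ⟨fun i x _ => by simp, fun i a _ x => by simp⟩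
  add_mem' := by
    rintro f g ⟨hf₁, hf₂⟩ ⟨hg₁, hg₂⟩
    refine ⟨fun i x hx => Submodule.add_mem _ (hf₁ i x hx) (hg₁ i x hx), fun i a ha x => ?_⟩
    rw [LinearMap.add_apply, LinearMap.add_apply, hf₂ i a ha, hg₂ i a ha, smul_add, smul_add]
  smul_mem' := by
    rintro r f ⟨hf₁, hf₂⟩
    refine ⟨fun i x hx => Submodule.smul_mem _ r (hf₁ i x hx), fun i a ha x => ?_⟩
    rw [LinearMap.smul_apply, LinearMap.smul_apply, hf₂ i a ha, smul_comm r, smul_algebra_smul_comm]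

/-- All homomorphisms of supermodules: the sums of even and odd ones. -/
def homs (V : SuperModule.{u, v, w₁} 𝒜) (W : SuperModule.{u, v, w₂} 𝒜) :
    Submodule R (V.carrier →ₗ[R] W.carrier) :=
  homOfParity V W 0 ⊔ homOfParity V W 1

/-- `V` and `W` are isomorphic through a homogeneous isomorphism, which may be even or odd
(so that `V` is isomorphic to its parity shift). For simple supermodules this is the same as being
isomorphic through any bijective element of `homs V W`. -/
def IsIso (V : SuperModule.{u, v, w₁} 𝒜) (W : SuperModule.{u, v, w₂} 𝒜) : Prop :=
  ∃ (p : ZMod 2) (e : V.carrier ≃ₗ[R] W.carrier), e.toLinearMap ∈ homOfParity V W p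

theorem IsIso.refl (V : SuperModule.{u, v, w} 𝒜) : IsIso V V :=
  ⟨0, LinearEquiv.refl R _, fun i x hx => by simpa using hx, fun i a _ x => by simp⟩

theorem exists_mem_add (V : SuperModule.{u, v, w} 𝒜) (x : V.carrier) :
    ∃ y ∈ V.grading 0, ∃ z ∈ V.grading 1, x = y + z := by
  have h : x ∈ (⨆ i, V.grading i) := by
    rw [V.isInternal.submodule_iSup_eq_top]; trivial
  have h' : (⨆ i, V.grading i) ≤ V.grading 0 ⊔ V.grading 1 := by
    refine iSup_le fun i => ?_
    fin_cases i
    · exact le_sup_left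
    · exact le_sup_right
  obtain ⟨y, hy, z, hz, e⟩ := Submodule.mem_sup.1 (h' h)
  exact ⟨y, hy, z, hz, e.symm⟩

theorem eq_zero_of_mem (V : SuperModule.{u, v, w} 𝒜) {i : ZMod 2} {x : V.carrier}
    (h₀ : x ∈ V.grading i) (h₁ : x ∈ V.grading (i + 1)) : x = 0 := by
  have h : Disjoint (V.grading i) (V.grading (i + 1)) :=
    V.isInternal.submodule_iSupIndep.pairwiseDisjoint (by simp)
  exact Submodule.disjoint_def.1 h x h₀ h₁

theorem IsIso.symm {V : SuperModule.{u, v, w₁} 𝒜} {W : SuperModule.{u, v, w₂} 𝒜}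
    (h : IsIso V W) : IsIso W V := by
  obtain ⟨p, e, h₁, h₂⟩ := h
  refine ⟨p, e.symm, fun i x hx => ?_, fun i a ha x => ?_⟩
  · -- the component of `e⁻¹ x` of the wrong parity is sent to zero
    have hpp : ∀ i p : ZMod 2, i + p + p = i ∧ (i + p + 1) + p = i + 1 := by decide
    have key : ∃ y ∈ V.grading (i + p), ∃ z ∈ V.grading (i + p + 1), e.symm x = y + z := by
      obtain ⟨y, hy, z, hz, hyz⟩ := V.exists_mem_add (e.symm x)
      generalize i + p = j
      fin_cases j
      · exact ⟨y, hy, z, hz, hyz⟩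
      · exact ⟨z, hz, y, hy, by rw [hyz, add_comm]⟩
    obtain ⟨y, hy, z, hz, hyz⟩ := key
    have hey : e y ∈ W.grading i := by simpa [(hpp i p).1] using h₁ _ y hy
    have hez : e z ∈ W.grading (i + 1) := by simpa [(hpp i p).2] using h₁ _ z hz
    have hx' : e z = x - e y := by
      rw [← e.apply_symm_apply x, hyz, map_add]; simp
    have hz0 : e z = 0 := W.eq_zero_of_mem (by rw [hx']; exact Submodule.sub_mem _ hx hey) hez
    have : z = 0 := by simpa using hz0
    simpa [hyz, this] using hy
  · apply e.injective
    have := h₂ i a ha (e.symm x)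
    simp only [LinearEquiv.coe_coe, LinearEquiv.apply_symm_apply] at this ⊢
    rw [Units.smul_def, map_zsmul, ← Units.smul_def, this, smul_smul,
      Int.units_mul_self, one_smul]

theorem IsIso.trans {V : SuperModule.{u, v, w₁} 𝒜} {W : SuperModule.{u, v, w₂} 𝒜}
    {U : SuperModule.{u, v, w₃} 𝒜} (h : IsIso V W) (h' : IsIso W U) : IsIso V U := by
  obtain ⟨p, e, h₁, h₂⟩ := h
  obtain ⟨q, f, h₃, h₄⟩ := h'
  refine ⟨p + q, e.trans f, fun i x hx => ?_, fun i a ha x => ?_⟩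
  · simpa [add_assoc] using h₃ _ _ (h₁ i x hx)
  · have h₂' := h₂ i a ha x
    have h₄' := h₄ i a ha (e x)
    simp only [LinearEquiv.coe_coe, LinearEquiv.trans_apply] at h₂' h₄' ⊢
    rw [h₂', Units.smul_def, map_zsmul, ← Units.smul_def, h₄', smul_smul, ← uzpow_add, add_mul]

/-- `V` is simple: it is non-zero and its only graded submodules are `0` and `V`. -/
def IsSimple (V : SuperModule.{u, v, w} 𝒜) : Prop :=
  Nontrivial V.carrier ∧ ∀ N : Submodule A V.carrier,
    (∀ x ∈ N, ∃ y ∈ V.grading 0, ∃ z ∈ V.grading 1, y ∈ N ∧ z ∈ N ∧ x = y + z) →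
      N = ⊥ ∨ N = ⊤

/-- Type `M`: the algebra of all (even and odd) endomorphisms is one-dimensional. -/
def IsTypeM (V : SuperModule.{u, v, w} 𝒜) : Prop :=
  Module.finrank R (homs V V) = 1

/-- Type `Q`: the algebra of all (even and odd) endomorphisms is two-dimensional. -/
def IsTypeQ (V : SuperModule.{u, v, w} 𝒜) : Prop :=
  Module.finrank R (homs V V) = 2

variable (𝒜) in
/-- Isomorphism as an equivalence relation on the simple supermodules. -/
def simpleSetoid : Setoid {V : SuperModule.{u, v, w} 𝒜 // V.IsSimple} where
  r V W := IsIso V.1 W.1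
  iseqv := ⟨fun V => IsIso.refl V.1, IsIso.symm, IsIso.trans⟩

variable (𝒜) in
/-- `Irr(A)`: the isomorphism classes of simple supermodules. -/
def Irr : Type max u v (w + 1) := Quotient (simpleSetoid.{u, v, w} 𝒜)

/-- The class of a simple supermodule in `Irr(A)`. -/
def IsSimple.toIrr {V : SuperModule.{u, v, w} 𝒜} (hV : V.IsSimple) : Irr.{u, v, w} 𝒜 :=
  Quotient.mk (simpleSetoid 𝒜) ⟨V, hV⟩

end Basic

section BaseChange

variable {R : Type u} {A : Type v} [CommRing R] [Ring A] [Algebra R A]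
  {𝒜 : ZMod 2 → Submodule R A}

/-- The action of `S ⊗ A` on `S ⊗ V`: `(s ⊗ a) (t ⊗ x) = (s t) ⊗ (a x)`. -/
def baseChangeAction (S : Type u') [CommRing S] [Algebra R S] (V : SuperModule.{u, v, w} 𝒜) :
    S ⊗[R] A →ₐ[S] Module.End S (S ⊗[R] V.carrier) :=
  Module.endTensorEndAlgHom.comp
    (Algebra.TensorProduct.map (Algebra.lsmul S S S) (Algebra.lsmul R R V.carrier))

theorem baseChangeAction_tmul (S : Type u') [CommRing S] [Algebra R S]
    (V : SuperModule.{u, v, w} 𝒜) (s t : S) (a : A) (x : V.carrier) :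
    V.baseChangeAction S (s ⊗ₜ[R] a) (t ⊗ₜ[R] x) = (s * t) ⊗ₜ[R] (a • x) := by
  simp [baseChangeAction, Module.endTensorEndAlgHom_apply]

/-- The base change `S ⊗ V`, a supermodule over the `S`-superalgebra `S ⊗ A` with
`(S ⊗ A)_i = S ⊗ A_i`, with grading `(S ⊗ V)_i = S ⊗ V_i`. -/
def baseChange (S : Type u') [CommRing S] [Algebra R S] (V : SuperModule.{u, v, w} 𝒜) :
    SuperModule.{u', max u' v, max u' w} (fun i => (𝒜 i).baseChange S) :=
  letI : Module (S ⊗[R] A) (S ⊗[R] V.carrier) :=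
    Module.compHom _ (V.baseChangeAction S).toRingHom
  { carrier := S ⊗[R] V.carrier
    isScalarTower := ⟨fun s b x => by
      change V.baseChangeAction S (s • b) x = s • V.baseChangeAction S b x
      rw [map_smul, LinearMap.smul_apply]⟩
    grading := fun i => (V.grading i).baseChange S
    isInternal := V.isInternal.baseChange
    smul_mem := by
      intro i j b x hb hx
      change V.baseChangeAction S b x ∈ _
      rw [Submodule.baseChange_eq_span] at hb hx
      refine Submodule.span_induction (p := fun b _ => V.baseChangeAction S b x ∈ _)
        ?_ ?_ ?_ ?_ hb
      · rintro _ ⟨a, ha, rfl⟩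
        refine Submodule.span_induction
          (p := fun x _ => V.baseChangeAction S (TensorProduct.mk R S A 1 a) x ∈ _)
          ?_ ?_ ?_ ?_ hx
        · rintro _ ⟨y, hy, rfl⟩
          simp only [TensorProduct.mk_apply]
          rw [baseChangeAction_tmul]
          exact Submodule.tmul_mem_baseChange_of_mem _ (V.smul_mem ha hy)
        · rw [map_zero]; exact Submodule.zero_mem _
        · intro x y _ _ h₁ h₂
          rw [map_add]; exact Submodule.add_mem _ h₁ h₂
        · intro s x _ h
          rw [map_smul]; exact Submodule.smul_mem _ s h
      · rw [map_zero]; exact Submodule.zero_mem _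
      · intro b c _ _ h₁ h₂
        rw [map_add]; exact Submodule.add_mem _ h₁ h₂
      · intro s b _ h
        rw [map_smul]; exact Submodule.smul_mem _ s h }

/-- `L` is a graded lattice in the supermodule `V` over `F ⊗ A`: an `A`-supermodule which is free
of finite rank over `R`, with an even isomorphism `F ⊗ L ≅ V`. (When `R` is a domain with fraction
field `F`, the map `x ↦ 1 ⊗ x` is injective on such an `L`, so `L` amounts to a graded
`A`-submodule of `V`.) -/
def IsLattice {F : Type u'} [CommRing F] [Algebra R F] (L : SuperModule.{u, v, w₁} 𝒜)
    (V : SuperModule.{u', max u' v, w₂} (fun i => (𝒜 i).baseChange F)) : Prop :=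
  Module.Free R L.carrier ∧ Module.Finite R L.carrier ∧
    ∃ e : (L.baseChange F).carrier ≃ₗ[F] V.carrier,
      e.toLinearMap ∈ homOfParity (L.baseChange F) V 0

end BaseChange

/-- A superalgebra over the field `k` is split if every simple supermodule stays simple under every
field extension `k'` of `k`. The extensions are taken in the universe of `k`, which contains an
algebraic closure of `k`. -/
def IsSplit {k : Type u} {B : Type v} [Field k] [Ring B] [Algebra k B]
    (ℬ : ZMod 2 → Submodule k B) : Prop :=
  ∀ V : SuperModule.{u, v, max u v} ℬ, V.IsSimple →
    ∀ (k' : Type u) [Field k'] [Algebra k k'], (V.baseChange k').IsSimple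

end SuperModule

end

/-! Write `k` for the residue field, `ϖ` for a uniformizer, and call an `A`-supermodule which is
free of finite rank over `O` a lattice. The theorem rests on one fact: when `k ⊗ A` is semisimple,
every `k ⊗ A`-linear map between the reductions of two lattices `L`, `L'` lifts to an `A`-linear map
`L → L'` (`exists_linearMap_lift`). An `O`-linear lift `f` exists by freeness, and the obstruction
`a ↦ a f - f a` is `ϖ d` for a derivation `d` of `A` with values in `Hom_O(L, L')`. Modulo `ϖ` a
derivation is an extension of `k ⊗ L` by `k ⊗ L'`, which splits, so it is inner; Nakayama's lemma
shows that all derivations are inner (`homDerivations_le_range`). If `d` comes from `g`, then `f - ϖ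
g` is the lift.

Let `V` be simple over `F ⊗ A` with lattice `L`. By splitness and an eigenvalue over the algebraic
closure, the even endomorphisms of `V` are scalars. Lifting carries this over to `k ⊗ L`, and
semisimplicity then makes `k ⊗ L` simple. Lifting also turns an isomorphism of reductions into a
non-zero map of generic fibres, an isomorphism by Schur's lemma. Conversely, a map of generic fibres
can be scaled by a power of `ϖ` so as to preserve the lattices and have non-zero reduction. This
comparison (`isoOfParity_residueField_iff`) respects parity. It gives well-definedness and
injectivity, and for `L = L'` in odd parity it compares types, since a simple module with scalar
even endomorphisms has type `Q` exactly when it has an odd automorphism.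

For surjectivity, a simple `W` over `k ⊗ A` is a quotient of the reduction of the regular lattice. A
graded submodule of the generic fibre cuts a lattice into two of smaller rank, one of which still
maps non-trivially to `W`; induction on the rank ends with a simple generic fibre
(`exists_simple_subquotient`). -/

noncomputable section

namespace SuperModule

/-! ### Homogeneous components, degree-shifting linear maps and Schur's lemma -/

section Graded

variable {R : Type u} {A : Type v} [CommRing R] [Ring A] [Algebra R A]
  {𝒜 : ZMod 2 → Submodule R A}

theorem two_eq_zero_or_one (i : ZMod 2) : i = 0 ∨ i = 1 := by
  fin_cases i
  · exact Or.inl rfl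
  · exact Or.inr rfl

theorem add_one_add_one (i : ZMod 2) : i + 1 + 1 = i := by
  rcases two_eq_zero_or_one i with rfl | rfl <;> rfl

theorem parity_add_self_add (i p : ZMod 2) : i + p + p = i := by
  rcases two_eq_zero_or_one p with rfl | rfl
  · simp
  · exact add_one_add_one i

/-- Every element of the algebra is the sum of an even and an odd one. -/
def Spans (𝒜 : ZMod 2 → Submodule R A) : Prop :=
  ∀ a : A, ∃ b ∈ 𝒜 0, ∃ c ∈ 𝒜 1, a = b + c

theorem isCompl_grading (V : SuperModule.{u, v, w} 𝒜) (i : ZMod 2) :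
    IsCompl (V.grading i) (V.grading (i + 1)) := by
  refine V.isInternal.isCompl (by simp) ?_
  ext j
  rcases two_eq_zero_or_one i with rfl | rfl <;> rcases two_eq_zero_or_one j with rfl | rfl <;>
    simp; decide

/-- The projection onto the component of parity `i`. -/
def proj (V : SuperModule.{u, v, w} 𝒜) (i : ZMod 2) : V.carrier →ₗ[R] V.carrier :=
  Submodule.projection _ _ (V.isCompl_grading i)

theorem proj_mem (V : SuperModule.{u, v, w} 𝒜) (i : ZMod 2) (x : V.carrier) :
    V.proj i x ∈ V.grading i :=
  Submodule.projection_apply_mem _ x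

theorem proj_of_mem (V : SuperModule.{u, v, w} 𝒜) {i : ZMod 2} {x : V.carrier}
    (hx : x ∈ V.grading i) : V.proj i x = x :=
  Submodule.projection_apply_left (V.isCompl_grading i) ⟨x, hx⟩

theorem proj_of_mem_add_one (V : SuperModule.{u, v, w} 𝒜) {i : ZMod 2} {x : V.carrier}
    (hx : x ∈ V.grading (i + 1)) : V.proj i x = 0 :=
  (Submodule.projection_apply_eq_zero_iff (V.isCompl_grading i)).2 hx

theorem proj_add_one_of_mem (V : SuperModule.{u, v, w} 𝒜) {i : ZMod 2} {x : V.carrier}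
    (hx : x ∈ V.grading i) : V.proj (i + 1) x = 0 :=
  V.proj_of_mem_add_one (by rwa [add_one_add_one])

theorem proj_of_mem_of_ne (V : SuperModule.{u, v, w} 𝒜) {i j : ZMod 2} (hij : i ≠ j)
    {x : V.carrier} (hx : x ∈ V.grading j) : V.proj i x = 0 := by
  have h : ∀ i j : ZMod 2, i ≠ j → i + 1 = j := by decide
  exact V.proj_of_mem_add_one (by rwa [h i j hij])

attribute [irreducible] proj

theorem proj_zero_add_proj_one (V : SuperModule.{u, v, w} 𝒜) (x : V.carrier) :
    V.proj 0 x + V.proj 1 x = x := by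
  obtain ⟨y, hy, z, hz, rfl⟩ := V.exists_mem_add x
  rw [map_add, map_add, V.proj_of_mem hy, V.proj_of_mem_of_ne (by decide) hz,
    V.proj_of_mem_of_ne (by decide) hy, V.proj_of_mem hz, add_zero, zero_add]

theorem proj_add_proj (V : SuperModule.{u, v, w} 𝒜) (i : ZMod 2) (x : V.carrier) :
    V.proj i x + V.proj (i + 1) x = x := by
  obtain ⟨y, hy, z, hz, rfl⟩ :=
    Submodule.mem_sup.1 (show x ∈ V.grading i ⊔ V.grading (i + 1) by
      rw [(V.isCompl_grading i).sup_eq_top]; trivial)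
  rw [map_add, map_add, V.proj_of_mem hy, V.proj_of_mem_add_one hz, V.proj_add_one_of_mem hy,
    V.proj_of_mem hz, add_zero, zero_add]

theorem proj_smul (V : SuperModule.{u, v, w} 𝒜) {j : ZMod 2} {a : A} (ha : a ∈ 𝒜 j)
    (i : ZMod 2) (x : V.carrier) : V.proj (j + i) (a • x) = a • V.proj i x := by
  conv_lhs => rw [← V.proj_add_proj i x, smul_add, map_add]
  have h := V.smul_mem ha (V.proj_mem (i + 1) x)
  rw [← add_assoc] at h
  rw [V.proj_of_mem (V.smul_mem ha (V.proj_mem i x)), V.proj_of_mem_add_one h, add_zero]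

/-- A submodule is graded if it contains the homogeneous components of its elements. -/
def IsGraded (V : SuperModule.{u, v, w} 𝒜) (N : Submodule A V.carrier) : Prop :=
  ∀ x ∈ N, ∃ y ∈ V.grading 0, ∃ z ∈ V.grading 1, y ∈ N ∧ z ∈ N ∧ x = y + z

theorem isGraded_iff (V : SuperModule.{u, v, w} 𝒜) (N : Submodule A V.carrier) :
    V.IsGraded N ↔ ∀ i, ∀ x ∈ N, V.proj i x ∈ N := by
  constructor
  · intro h i x hx
    obtain ⟨y, hy, z, hz, hyN, hzN, rfl⟩ := h x hx
    rcases two_eq_zero_or_one i with rfl | rfl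
    · rwa [map_add, V.proj_of_mem hy, V.proj_of_mem_of_ne (by decide) hz, add_zero]
    · rwa [map_add, V.proj_of_mem hz, V.proj_of_mem_of_ne (by decide) hy, zero_add]
  · intro h x hx
    exact ⟨_, V.proj_mem 0 x, _, V.proj_mem 1 x, h 0 x hx, h 1 x hx,
      (V.proj_zero_add_proj_one x).symm⟩

theorem IsSimple.eq_bot_or_eq_top {V : SuperModule.{u, v, w} 𝒜} (hV : V.IsSimple)
    {N : Submodule A V.carrier} (hN : V.IsGraded N) : N = ⊥ ∨ N = ⊤ :=
  hV.2 N hN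

/-- The `A`-linear maps which shift the degree by `p`. -/
def IsHomogeneous (V : SuperModule.{u, v, w₁} 𝒜) (W : SuperModule.{u, v, w₂} 𝒜) (p : ZMod 2)
    (f : V.carrier →ₗ[A] W.carrier) : Prop :=
  ∀ i, ∀ x ∈ V.grading i, f x ∈ W.grading (i + p)

/-- `V` and `W` are isomorphic through an `A`-linear map which shifts the degree by `p`. -/
def IsoOfParity (V : SuperModule.{u, v, w₁} 𝒜) (W : SuperModule.{u, v, w₂} 𝒜) (p : ZMod 2) :
    Prop :=
  ∃ e : V.carrier ≃ₗ[A] W.carrier, IsHomogeneous V W p e.toLinearMap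

section Maps

variable {V : SuperModule.{u, v, w₁} 𝒜} {W : SuperModule.{u, v, w₂} 𝒜}
  {U : SuperModule.{u, v, w₃} 𝒜} {p q : ZMod 2}

theorem map_smul_base (f : V.carrier →ₗ[A] W.carrier) (r : R) (x : V.carrier) :
    f (r • x) = r • f x :=
  (f.restrictScalars R).map_smul r x

theorem IsHomogeneous.map_proj {f : V.carrier →ₗ[A] W.carrier} (hf : IsHomogeneous V W p f)
    (i : ZMod 2) (x : V.carrier) : W.proj (i + p) (f x) = f (V.proj i x) := by
  conv_lhs => rw [← V.proj_add_proj i x, map_add, map_add]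
  rw [W.proj_of_mem (hf _ _ (V.proj_mem i x)), W.proj_of_mem_add_one, add_zero]
  have := hf _ _ (V.proj_mem (i + 1) x)
  rwa [add_right_comm] at this

theorem IsHomogeneous.comp {g : W.carrier →ₗ[A] U.carrier} {f : V.carrier →ₗ[A] W.carrier}
    (hg : IsHomogeneous W U q g) (hf : IsHomogeneous V W p f) :
    IsHomogeneous V U (p + q) (g ∘ₗ f) := fun i x hx => by
  have := hg _ _ (hf i x hx)
  rwa [add_assoc] at this

theorem IsHomogeneous.symm {e : V.carrier ≃ₗ[A] W.carrier}
    (he : IsHomogeneous V W p e.toLinearMap) : IsHomogeneous W V p e.symm.toLinearMap := by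
  intro i x hx
  have h := he.map_proj (i + p) (e.symm x)
  simp only [LinearEquiv.coe_coe, e.apply_symm_apply, parity_add_self_add] at h
  rw [W.proj_of_mem hx] at h
  have : e.symm x = V.proj (i + p) (e.symm x) := by rw [LinearEquiv.symm_apply_eq]; exact h
  rw [LinearEquiv.coe_coe, this]
  exact V.proj_mem _ _

theorem IsHomogeneous.isGraded_ker {f : V.carrier →ₗ[A] W.carrier} (hf : IsHomogeneous V W p f) :
    V.IsGraded (LinearMap.ker f) := by
  rw [isGraded_iff]
  intro i x hx
  rw [LinearMap.mem_ker] at hx ⊢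
  rw [← hf.map_proj, hx, map_zero]

theorem IsHomogeneous.isGraded_range {f : V.carrier →ₗ[A] W.carrier}
    (hf : IsHomogeneous V W p f) : W.IsGraded (LinearMap.range f) := by
  rw [isGraded_iff]
  rintro i _ ⟨x, rfl⟩
  exact ⟨V.proj (i + p) x, by rw [← hf.map_proj, parity_add_self_add]⟩

theorem IsoOfParity.symm (h : IsoOfParity V W p) : IsoOfParity W V p :=
  ⟨h.choose.symm, h.choose_spec.symm⟩

theorem IsoOfParity.trans (h : IsoOfParity V W p) (h' : IsoOfParity W U q) :
    IsoOfParity V U (p + q) := by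
  obtain ⟨e, he⟩ := h
  obtain ⟨f, hf⟩ := h'
  exact ⟨e.trans f, hf.comp he⟩

/-- Schur's lemma. -/
theorem IsHomogeneous.isoOfParity {f : V.carrier →ₗ[A] W.carrier} (hf : IsHomogeneous V W p f)
    (hV : V.IsSimple) (hW : W.IsSimple) (h0 : f ≠ 0) : IsoOfParity V W p := by
  have hk : LinearMap.ker f = ⊥ := by
    refine (hV.eq_bot_or_eq_top hf.isGraded_ker).resolve_right fun h => h0 ?_
    exact LinearMap.ker_eq_top.1 h
  have hr : LinearMap.range f = ⊤ := by
    refine (hW.eq_bot_or_eq_top hf.isGraded_range).resolve_left fun h => h0 ?_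
    exact LinearMap.range_eq_bot.1 h
  exact ⟨LinearEquiv.ofBijective f ⟨LinearMap.ker_eq_bot.1 hk, LinearMap.range_eq_top.1 hr⟩, hf⟩

theorem IsoOfParity.isSimple (h : IsoOfParity V W p) (hV : V.IsSimple) : W.IsSimple := by
  obtain ⟨e, he⟩ := h
  have := hV.1
  refine ⟨e.symm.toEquiv.nontrivial, fun N hN => ?_⟩
  have hN' : V.IsGraded (N.comap e.toLinearMap) := by
    rw [isGraded_iff]
    intro i x hx
    rw [Submodule.mem_comap] at hx ⊢
    rw [← he.map_proj]
    exact (isGraded_iff W N).1 hN _ _ hx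
  have hmap : (N.comap e.toLinearMap).map e.toLinearMap = N :=
    Submodule.map_comap_eq_of_surjective e.surjective N
  rcases hV.eq_bot_or_eq_top hN' with h | h
  · left; rw [← hmap, h, Submodule.map_bot]
  · right; rw [← hmap, h, Submodule.map_top, LinearMap.range_eq_top.2 e.surjective]

/-- The component of degree `p` of an `A`-linear map. -/
theorem exists_component (hA : Spans 𝒜) (f : V.carrier →ₗ[A] W.carrier) (p : ZMod 2) :
    ∃ g : V.carrier →ₗ[A] W.carrier, IsHomogeneous V W p g ∧
      ∀ i, ∀ x ∈ V.grading i, g x = W.proj (i + p) (f x) := by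
  let g₀ : V.carrier →ₗ[R] W.carrier :=
    W.proj (0 + p) ∘ₗ f.restrictScalars R ∘ₗ V.proj 0 +
      W.proj (1 + p) ∘ₗ f.restrictScalars R ∘ₗ V.proj 1
  have hg : ∀ i x, x ∈ V.grading i → g₀ x = W.proj (i + p) (f x) := by
    intro i x hx
    rcases two_eq_zero_or_one i with rfl | rfl
    · have h1 : V.proj 1 x = 0 := V.proj_of_mem_of_ne (by decide) hx
      simp [g₀, V.proj_of_mem hx, h1]
    · have h1 : V.proj 0 x = 0 := V.proj_of_mem_of_ne (by decide) hx
      simp [g₀, V.proj_of_mem hx, h1]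
  have hsm : ∀ j, ∀ a ∈ 𝒜 j, ∀ x, g₀ (a • x) = a • g₀ x := by
    intro j a ha x
    have key : ∀ (i : ZMod 2) (y : V.carrier), y ∈ V.grading i → g₀ (a • y) = a • g₀ y := by
      intro i y hy
      rw [hg _ _ (V.smul_mem ha hy), hg _ _ hy, map_smul, add_assoc, W.proj_smul ha]
    rw [← V.proj_zero_add_proj_one x, smul_add, map_add, map_add, smul_add,
      key _ _ (V.proj_mem _ x), key _ _ (V.proj_mem _ x)]
  refine ⟨{ g₀ with map_smul' := fun a x => ?_ }, fun i x hx => ?_, hg⟩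
  · obtain ⟨b, hb, c, hc, rfl⟩ := hA a
    change g₀ ((b + c) • x) = (b + c) • g₀ x
    rw [add_smul, add_smul, map_add, hsm 0 b hb, hsm 1 c hc]
  · change g₀ x ∈ _
    rw [hg i x hx]
    exact W.proj_mem _ _

end Maps

/-! ### Trading the sign convention for `A`-linearity -/

section Twist

/-- The parity involution `x ↦ (-1)^{|x|} x`. -/
def parityInvolution (V : SuperModule.{u, v, w} 𝒜) : V.carrier ≃ₗ[R] V.carrier :=
  LinearEquiv.ofInvolutive (V.proj 0 - V.proj 1) fun x => by
    have h0 := V.proj_of_mem (V.proj_mem 0 x)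
    have h1 := V.proj_of_mem (V.proj_mem 1 x)
    have h2 : V.proj 1 (V.proj 0 x) = 0 := V.proj_of_mem_of_ne (by decide) (V.proj_mem 0 x)
    have h3 : V.proj 0 (V.proj 1 x) = 0 := V.proj_of_mem_of_ne (by decide) (V.proj_mem 1 x)
    have h4 : V.proj 0 x + V.proj 1 x = x := V.proj_zero_add_proj_one x
    simp [h0, h1, h2, h3, h4]

variable {V : SuperModule.{u, v, w₁} 𝒜} {W : SuperModule.{u, v, w₂} 𝒜}

theorem parityInvolution_apply (V : SuperModule.{u, v, w} 𝒜) (x : V.carrier) :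
    V.parityInvolution x = V.proj 0 x - V.proj 1 x := rfl

theorem parityInvolution_self (V : SuperModule.{u, v, w} 𝒜) (x : V.carrier) :
    V.parityInvolution (V.parityInvolution x) = x :=
  V.parityInvolution.left_inv x

theorem parityInvolution_mem (V : SuperModule.{u, v, w} 𝒜) {i : ZMod 2} {x : V.carrier}
    (hx : x ∈ V.grading i) : V.parityInvolution x ∈ V.grading i := by
  rw [parityInvolution_apply]
  rcases two_eq_zero_or_one i with rfl | rfl
  · have h1 : V.proj 1 x = 0 := V.proj_of_mem_of_ne (by decide) hx
    rw [h1, sub_zero]; exact V.proj_mem _ _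
  · have h1 : V.proj 0 x = 0 := V.proj_of_mem_of_ne (by decide) hx
    rw [h1, zero_sub]; exact Submodule.neg_mem _ (V.proj_mem _ _)

theorem parityInvolution_smul_even (V : SuperModule.{u, v, w} 𝒜) {a : A} (ha : a ∈ 𝒜 0)
    (x : V.carrier) : V.parityInvolution (a • x) = a • V.parityInvolution x := by
  have h0 : V.proj 0 (a • x) = a • V.proj 0 x := by simpa only [zero_add] using V.proj_smul ha 0 x
  have h1 : V.proj 1 (a • x) = a • V.proj 1 x := by simpa only [zero_add] using V.proj_smul ha 1 x
  rw [parityInvolution_apply, parityInvolution_apply, h0, h1, smul_sub]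

theorem parityInvolution_smul_odd (V : SuperModule.{u, v, w} 𝒜) {a : A} (ha : a ∈ 𝒜 1)
    (x : V.carrier) : V.parityInvolution (a • x) = -(a • V.parityInvolution x) := by
  have h0 : V.proj 1 (a • x) = a • V.proj 0 x := by simpa only [add_zero] using V.proj_smul ha 0 x
  have h1 : V.proj 0 (a • x) = a • V.proj 1 x := by
    have h : (1 : ZMod 2) + 1 = 0 := rfl
    simpa only [h] using V.proj_smul ha 1 x
  rw [parityInvolution_apply, parityInvolution_apply, h0, h1, smul_sub, neg_sub]

theorem mem_homOfParity_zero (hA : Spans 𝒜) (f : V.carrier →ₗ[R] W.carrier) :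
    f ∈ homOfParity V W 0 ↔ ∃ g : V.carrier →ₗ[A] W.carrier, IsHomogeneous V W 0 g ∧
      ∀ x, g x = f x := by
  constructor
  · rintro ⟨h₁, h₂⟩
    have h₂' : ∀ i, ∀ a ∈ 𝒜 i, ∀ x, f (a • x) = a • f x := fun i a ha x => by
      simpa using h₂ i a ha x
    refine ⟨{ f with map_smul' := fun a x => ?_ }, h₁, fun x => rfl⟩
    obtain ⟨b, hb, c, hc, rfl⟩ := hA a
    change f ((b + c) • x) = (b + c) • f x
    rw [add_smul, add_smul, map_add, h₂' 0 b hb, h₂' 1 c hc]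
  · rintro ⟨g, hg, h⟩
    refine ⟨fun i x hx => by rw [← h]; exact hg i x hx, fun i a ha x => ?_⟩
    rw [← h, ← h, map_smul]
    simp

/-- Moving an odd scalar past an odd map costs a sign, and moving it past the parity involution
costs another. The two cancel in the composite, so odd homomorphisms can be replaced by honest
`A`-linear maps. -/
theorem mem_homOfParity_one (hA : Spans 𝒜) (f : V.carrier →ₗ[R] W.carrier) :
    f ∈ homOfParity V W 1 ↔ ∃ g : V.carrier →ₗ[A] W.carrier, IsHomogeneous V W 1 g ∧
      ∀ x, g x = f (V.parityInvolution x) := by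
  constructor
  · rintro ⟨h₁, h₂⟩
    have h0 : ∀ a ∈ 𝒜 0, ∀ x, f (a • x) = a • f x := fun a ha x => by
      simpa using h₂ 0 a ha x
    have h1 : ∀ a ∈ 𝒜 1, ∀ x, f (a • x) = -(a • f x) := fun a ha x => by
      have := h₂ 1 a ha x
      rwa [mul_one, uzpow_one, Units.neg_smul, one_smul] at this
    refine ⟨{ f ∘ₗ V.parityInvolution.toLinearMap with map_smul' := fun a x => ?_ },
      fun i x hx => h₁ i _ (V.parityInvolution_mem hx), fun x => rfl⟩
    obtain ⟨b, hb, c, hc, rfl⟩ := hA a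
    change f (V.parityInvolution ((b + c) • x)) = (b + c) • f (V.parityInvolution x)
    rw [add_smul, add_smul, map_add, map_add, V.parityInvolution_smul_even hb,
      V.parityInvolution_smul_odd hc, map_neg, h0 b hb, h1 c hc, neg_neg]
  · rintro ⟨g, hg, h⟩
    have h' : ∀ x, f x = g (V.parityInvolution x) := fun x => by
      rw [h, V.parityInvolution_self]
    refine ⟨fun i x hx => ?_, fun i a ha x => ?_⟩
    · rw [h']; exact hg i _ (V.parityInvolution_mem hx)
    · rw [h', h']
      rcases two_eq_zero_or_one i with rfl | rfl
      · rw [V.parityInvolution_smul_even ha, map_smul]; simp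
      · rw [V.parityInvolution_smul_odd ha, map_neg, map_smul, mul_one, uzpow_one,
          Units.neg_smul, one_smul]

theorem isoOfParity_iff (hA : Spans 𝒜) (p : ZMod 2) : IsoOfParity V W p ↔
    ∃ e : V.carrier ≃ₗ[R] W.carrier, e.toLinearMap ∈ homOfParity V W p := by
  constructor
  · rintro ⟨e, he⟩
    rcases two_eq_zero_or_one p with rfl | rfl
    · exact ⟨e.restrictScalars R, (mem_homOfParity_zero hA _).2 ⟨e.toLinearMap, he, fun x => rfl⟩⟩
    · refine ⟨V.parityInvolution.trans (e.restrictScalars R),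
        (mem_homOfParity_one hA _).2 ⟨e.toLinearMap, he, fun x => ?_⟩⟩
      simp [parityInvolution_self]
  · rintro ⟨e, he⟩
    rcases two_eq_zero_or_one p with rfl | rfl
    · obtain ⟨g, hg, h⟩ := (mem_homOfParity_zero hA _).1 he
      refine ⟨LinearEquiv.ofBijective g ?_, hg⟩
      have : ⇑g = ⇑e := funext h
      rw [this]; exact e.bijective
    · obtain ⟨g, hg, h⟩ := (mem_homOfParity_one hA _).1 he
      refine ⟨LinearEquiv.ofBijective g ?_, hg⟩
      have : ⇑g = ⇑(V.parityInvolution.trans e) := funext h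
      rw [this]; exact LinearEquiv.bijective _

theorem isIso_iff (hA : Spans 𝒜) : IsIso V W ↔ ∃ p, IsoOfParity V W p :=
  exists_congr fun p => (isoOfParity_iff hA p).symm

end Twist

end Graded

/-! ### Types `M` and `Q` in terms of odd automorphisms -/

section Types

variable {K : Type u} {A : Type v} [Field K] [Ring A] [Algebra K A]
  {𝒜 : ZMod 2 → Submodule K A}

/-- Every even endomorphism is a scalar. -/
def HasScalarEvenEnds {R : Type u} {A : Type v} [CommRing R] [Ring A] [Algebra R A]
    {𝒜 : ZMod 2 → Submodule R A} (V : SuperModule.{u, v, w} 𝒜) : Prop :=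
  ∀ f : V.carrier →ₗ[A] V.carrier, IsHomogeneous V V 0 f → ∃ c : R, ∀ x, f x = c • x

variable {V : SuperModule.{u, v, w} 𝒜}

theorem homOfParity_zero_eq_span (hA : Spans 𝒜) (hs : HasScalarEvenEnds V) :
    homOfParity V V 0 = Submodule.span K {LinearMap.id} := by
  ext f
  rw [Submodule.mem_span_singleton]
  constructor
  · intro hf
    obtain ⟨g, hg, h⟩ := (mem_homOfParity_zero hA f).1 hf
    obtain ⟨c, hc⟩ := hs g hg
    exact ⟨c, LinearMap.ext fun x => by rw [← h, hc]; rfl⟩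
  · rintro ⟨c, rfl⟩
    refine Submodule.smul_mem _ _ ((mem_homOfParity_zero hA _).2
      ⟨LinearMap.id, fun i x hx => by simpa using hx, fun x => rfl⟩)

/-- By Schur's lemma a non-zero odd endomorphism would be an isomorphism, so only the even scalars
remain. -/
theorem finrank_homs_of_not_isoOfParity_one (hA : Spans 𝒜) (hV : V.IsSimple)
    (hs : HasScalarEvenEnds V) (h : ¬ IsoOfParity V V 1) : V.IsTypeM := by
  have h1 : homOfParity V V 1 = ⊥ := by
    rw [eq_bot_iff]
    intro f hf
    obtain ⟨g, hg, hgf⟩ := (mem_homOfParity_one hA f).1 hf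
    have hg0 : g = 0 := by
      by_contra hne
      exact h (hg.isoOfParity hV hV hne)
    rw [Submodule.mem_bot]
    ext x
    rw [← V.parityInvolution_self x, ← hgf, hg0]
    rfl
  have := hV.1
  rw [IsTypeM, homs, h1, sup_bot_eq, homOfParity_zero_eq_span hA hs]
  refine finrank_span_singleton fun h => ?_
  obtain ⟨x, hx⟩ := exists_ne (0 : V.carrier)
  exact hx (LinearMap.congr_fun h x)

theorem finrank_homs_of_isoOfParity_one (hA : Spans 𝒜) (hV : V.IsSimple)
    (hs : HasScalarEvenEnds V) (h : IsoOfParity V V 1) : V.IsTypeQ := by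
  have := hV.1
  obtain ⟨e, he⟩ := h
  obtain ⟨x, hx⟩ := exists_ne (0 : V.carrier)
  let u : V.carrier →ₗ[K] V.carrier :=
    (V.parityInvolution.trans (e.restrictScalars K)).toLinearMap
  have hu : u ∈ homOfParity V V 1 :=
    (mem_homOfParity_one hA _).2 ⟨e.toLinearMap, he, fun x => by
      simp [u, parityInvolution_self]⟩
  have hu0 : u ≠ 0 := fun h0 => hx (by
    have := LinearMap.congr_fun h0 x
    simpa [u] using this)
  have h1 : homOfParity V V 1 = Submodule.span K {u} := by
    refine le_antisymm (fun f hf => ?_) ((Submodule.span_singleton_le_iff_mem _ _).2 hu)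
    obtain ⟨g, hg, hgf⟩ := (mem_homOfParity_one hA f).1 hf
    -- Two odd maps compose to one of degree `1 + 1`, which is `0` by computation. Hence any odd
    -- endomorphism is a scalar multiple of the fixed odd automorphism.
    obtain ⟨c, hc⟩ := hs (g ∘ₗ e.symm.toLinearMap) (hg.comp he.symm)
    rw [Submodule.mem_span_singleton]
    refine ⟨c, LinearMap.ext fun y => ?_⟩
    have h2 := hc (e (V.parityInvolution y))
    simp only [LinearMap.comp_apply, LinearEquiv.coe_coe, e.symm_apply_apply, hgf,
      parityInvolution_self] at h2
    rw [h2]; rfl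
  have hinf : homOfParity V V 0 ⊓ homOfParity V V 1 = ⊥ := by
    rw [eq_bot_iff]
    rintro f ⟨hf0, hf1⟩
    have : ∀ i, ∀ y ∈ V.grading i, f y = 0 := fun i y hy => by
      have h0 := hf0.1 i y hy
      rw [add_zero] at h0
      exact V.eq_zero_of_mem h0 (hf1.1 i y hy)
    rw [Submodule.mem_bot]
    ext y
    rw [← V.proj_zero_add_proj_one y, map_add, this _ _ (V.proj_mem _ _), this _ _ (V.proj_mem _ _)]
    simp
  have h0 := homOfParity_zero_eq_span hA hs
  have : Module.Finite K (homOfParity V V 0) := by rw [h0]; infer_instance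
  have : Module.Finite K (homOfParity V V 1) := by rw [h1]; infer_instance
  have hid : (LinearMap.id : V.carrier →ₗ[K] V.carrier) ≠ 0 := fun h =>
    hx (LinearMap.congr_fun h x)
  have := Submodule.finrank_sup_add_finrank_inf_eq (homOfParity V V 0) (homOfParity V V 1)
  rw [hinf, finrank_bot, add_zero] at this
  rw [IsTypeQ, homs, this, h0, h1, finrank_span_singleton hid, finrank_span_singleton hu0]

theorem isTypeM_iff (hA : Spans 𝒜) (hV : V.IsSimple) (hs : HasScalarEvenEnds V) :
    V.IsTypeM ↔ ¬ IsoOfParity V V 1 := by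
  refine ⟨fun hM h => ?_, finrank_homs_of_not_isoOfParity_one hA hV hs⟩
  have hQ := finrank_homs_of_isoOfParity_one hA hV hs h
  rw [IsTypeM] at hM
  rw [IsTypeQ, hM] at hQ
  exact absurd hQ (by norm_num)

theorem isTypeQ_iff (hA : Spans 𝒜) (hV : V.IsSimple) (hs : HasScalarEvenEnds V) :
    V.IsTypeQ ↔ IsoOfParity V V 1 := by
  refine ⟨fun hQ => ?_, finrank_homs_of_isoOfParity_one hA hV hs⟩
  by_contra h
  have hM := finrank_homs_of_not_isoOfParity_one hA hV hs h
  rw [IsTypeM] at hM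
  rw [IsTypeQ, hM] at hQ
  exact absurd hQ (by norm_num)

end Types

end SuperModule

namespace SuperModule

/-! ### Base change of supermodules and of their homomorphisms -/

section BaseChangeMaps

variable {R : Type u} {A : Type v} [CommRing R] [Ring A] [Algebra R A]
  {𝒜 : ZMod 2 → Submodule R A}

theorem Spans.of_gradedAlgebra (𝒜 : ZMod 2 → Submodule R A) [GradedAlgebra 𝒜] : Spans 𝒜 := by
  intro a
  have hc := (DirectSum.Decomposition.isInternal 𝒜).isCompl (i := 0) (j := 1) (by decide) (by
    ext j; rcases two_eq_zero_or_one j with rfl | rfl <;> simp)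
  obtain ⟨y, hy, z, hz, h⟩ := Submodule.mem_sup.1
    (show a ∈ 𝒜 0 ⊔ 𝒜 1 by rw [hc.sup_eq_top]; trivial)
  exact ⟨y, hy, z, hz, h.symm⟩

variable (S : Type u') [CommRing S] [Algebra R S]

theorem Spans.baseChange (hA : Spans 𝒜) : Spans fun i => (𝒜 i).baseChange S := by
  intro a
  induction a using TensorProduct.induction_on with
  | zero => exact ⟨0, Submodule.zero_mem _, 0, Submodule.zero_mem _, (add_zero 0).symm⟩
  | tmul s a =>
    obtain ⟨b, hb, c, hc, rfl⟩ := hA a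
    exact ⟨_, Submodule.tmul_mem_baseChange_of_mem s hb, _,
      Submodule.tmul_mem_baseChange_of_mem s hc, TensorProduct.tmul_add _ _ _⟩
  | add a a' h h' =>
    obtain ⟨b, hb, c, hc, rfl⟩ := h
    obtain ⟨b', hb', c', hc', rfl⟩ := h'
    exact ⟨_, Submodule.add_mem _ hb hb', _, Submodule.add_mem _ hc hc',
      add_add_add_comm _ _ _ _⟩

/-- The canonical map `x ↦ 1 ⊗ x` into the base change. -/
def toBaseChange (V : SuperModule.{u, v, w} 𝒜) : V.carrier →+ (V.baseChange S).carrier :=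
  (TensorProduct.mk R S V.carrier 1).toAddMonoidHom

variable {S}

theorem toBaseChange_apply (V : SuperModule.{u, v, w} 𝒜) (x : V.carrier) :
    V.toBaseChange S x = (1 : S) ⊗ₜ[R] x := rfl

theorem smul_toBaseChange (V : SuperModule.{u, v, w} 𝒜) (s : S) (x : V.carrier) :
    s • V.toBaseChange S x = s ⊗ₜ[R] x := by
  change s • ((1 : S) ⊗ₜ[R] x) = s ⊗ₜ[R] x
  rw [TensorProduct.smul_tmul', smul_eq_mul, mul_one]

theorem toBaseChange_smul_base (V : SuperModule.{u, v, w} 𝒜) (r : R) (x : V.carrier) :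
    V.toBaseChange S (r • x) = algebraMap R S r • V.toBaseChange S x := by
  rw [smul_toBaseChange, toBaseChange_apply, ← TensorProduct.smul_tmul,
    Algebra.algebraMap_eq_smul_one]

theorem tmul_smul_toBaseChange (V : SuperModule.{u, v, w} 𝒜) (s : S) (a : A) (x : V.carrier) :
    (s ⊗ₜ[R] a : S ⊗[R] A) • V.toBaseChange S x = s • V.toBaseChange S (a • x) := by
  rw [smul_toBaseChange, toBaseChange_apply]
  refine (V.baseChangeAction_tmul S s 1 a x).trans ?_
  rw [mul_one]

theorem toBaseChange_smul (V : SuperModule.{u, v, w} 𝒜) (a : A) (x : V.carrier) :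
    V.toBaseChange S (a • x) = ((1 : S) ⊗ₜ[R] a : S ⊗[R] A) • V.toBaseChange S x := by
  rw [tmul_smul_toBaseChange, one_smul]

theorem toBaseChange_mem (V : SuperModule.{u, v, w} 𝒜) {i : ZMod 2} {x : V.carrier}
    (hx : x ∈ V.grading i) : V.toBaseChange S x ∈ (V.baseChange S).grading i :=
  Submodule.tmul_mem_baseChange_of_mem _ hx

theorem baseChange_grading_eq_span (V : SuperModule.{u, v, w} 𝒜) (i : ZMod 2) :
    (V.baseChange S).grading i = Submodule.span S (V.toBaseChange S '' V.grading i) :=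
  Submodule.baseChange_eq_span S (V.grading i)

theorem proj_toBaseChange (V : SuperModule.{u, v, w} 𝒜) (i : ZMod 2) (x : V.carrier) :
    (V.baseChange S).proj i (V.toBaseChange S x) = V.toBaseChange S (V.proj i x) := by
  conv_lhs => rw [← V.proj_add_proj i x, map_add, map_add]
  rw [proj_of_mem _ (V.toBaseChange_mem (V.proj_mem i x)),
    proj_of_mem_add_one _ (V.toBaseChange_mem (V.proj_mem (i + 1) x)), add_zero]

@[elab_as_elim]
theorem baseChange_induction {V : SuperModule.{u, v, w} 𝒜} {P : (V.baseChange S).carrier → Prop}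
    (y : (V.baseChange S).carrier) (zero : P 0) (smul : ∀ (s : S) x, P (s • V.toBaseChange S x))
    (add : ∀ y z, P y → P z → P (y + z)) : P y :=
  TensorProduct.induction_on (motive := P) y zero
    (fun s x => by rw [← smul_toBaseChange]; exact smul s x) add

section Extend

variable {V : SuperModule.{u, v, w₁} 𝒜} {W : SuperModule.{u, v, w₂} 𝒜}
  {X : SuperModule.{u', max u' v, w₃} fun i => (𝒜 i).baseChange S} {p : ZMod 2}

theorem baseChange_hom_ext {f g : (V.baseChange S).carrier →ₗ[S ⊗[R] A] X.carrier}
    (h : ∀ x, f (V.toBaseChange S x) = g (V.toBaseChange S x)) : f = g := by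
  refine LinearMap.ext fun y => ?_
  induction y using baseChange_induction with
  | zero => rw [map_zero, map_zero]
  | smul s x => rw [map_smul_base, map_smul_base, h]
  | add y z hy hz => rw [map_add, map_add, hy, hz]

theorem isHomogeneous_of_toBaseChange {f : (V.baseChange S).carrier →ₗ[S ⊗[R] A] X.carrier}
    (h : ∀ i, ∀ x ∈ V.grading i, f (V.toBaseChange S x) ∈ X.grading (i + p)) :
    IsHomogeneous (V.baseChange S) X p f := by
  intro i y hy
  rw [baseChange_grading_eq_span] at hy
  have hle : Submodule.span S (V.toBaseChange S '' V.grading i) ≤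
      (X.grading (i + p)).comap (f.restrictScalars S) := by
    rw [Submodule.span_le]
    rintro _ ⟨x, hx, rfl⟩
    exact h i x hx
  exact hle hy

/-- An `S`-linear map from a base change which is `A`-linear on `V` is `S ⊗ A`-linear. -/
def extendLinear (g : (V.baseChange S).carrier →ₗ[S] X.carrier)
    (h : ∀ a x, g (V.toBaseChange S (a • x)) =
      ((1 : S) ⊗ₜ[R] a : S ⊗[R] A) • g (V.toBaseChange S x)) :
    (V.baseChange S).carrier →ₗ[S ⊗[R] A] X.carrier :=
  { g with
    map_smul' := fun b y => by
      change g (b • y) = b • g y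
      induction b using TensorProduct.induction_on with
      | zero => rw [zero_smul, zero_smul, map_zero]
      | add b c hb hc => rw [add_smul, add_smul, map_add, hb, hc]
      | tmul s a =>
        have hsa : (s ⊗ₜ[R] a : S ⊗[R] A) = s • ((1 : S) ⊗ₜ[R] a) := by
          rw [TensorProduct.smul_tmul', smul_eq_mul, mul_one]
        rw [hsa, smul_assoc, smul_assoc, map_smul]
        congr 1
        induction y using baseChange_induction with
        | zero => rw [smul_zero, map_zero, smul_zero]
        | add y z hy hz => rw [smul_add, map_add, map_add, smul_add, hy, hz]
        | smul t x =>
          rw [smul_algebra_smul_comm, g.map_smul t, g.map_smul t, ← toBaseChange_smul, h,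
            smul_algebra_smul_comm] }

variable (S) in
/-- The base change of an `A`-linear map. -/
def baseChangeMap (f : V.carrier →ₗ[A] W.carrier) :
    (V.baseChange S).carrier →ₗ[S ⊗[R] A] (W.baseChange S).carrier :=
  extendLinear (X := W.baseChange S) ((f.restrictScalars R).baseChange S) fun a x => by
    change W.toBaseChange S (f (a • x)) = _ • W.toBaseChange S (f x)
    rw [map_smul, toBaseChange_smul]

theorem baseChangeMap_toBaseChange (f : V.carrier →ₗ[A] W.carrier) (x : V.carrier) :
    baseChangeMap S f (V.toBaseChange S x) = W.toBaseChange S (f x) := rfl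

theorem IsHomogeneous.baseChange {f : V.carrier →ₗ[A] W.carrier} (hf : IsHomogeneous V W p f) :
    IsHomogeneous (V.baseChange S) (W.baseChange S) p (baseChangeMap S f) :=
  isHomogeneous_of_toBaseChange fun i x hx => by
    rw [baseChangeMap_toBaseChange]
    exact W.toBaseChange_mem (hf i x hx)

end Extend

theorem toBaseChange_injective (V : SuperModule.{u, v, w} 𝒜) [Module.Free R V.carrier]
    (h : Function.Injective (algebraMap R S)) : Function.Injective (V.toBaseChange S) := by
  have h1 : Function.Injective ((Algebra.linearMap R S).rTensor V.carrier) :=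
    Module.Flat.rTensor_preserves_injective_linearMap _ h
  intro x y hxy
  have h2 : ∀ z, V.toBaseChange S z = (Algebra.linearMap R S).rTensor V.carrier (1 ⊗ₜ z) :=
    fun z => by simp only [toBaseChange_apply, LinearMap.rTensor_tmul,
      Algebra.linearMap_apply, map_one]; rfl
  rw [h2, h2] at hxy
  have := congrArg (TensorProduct.lid R V.carrier) (h1 hxy)
  simpa using this

theorem nontrivial_of_nontrivial_baseChange {V : SuperModule.{u, v, w} 𝒜}
    (h : Nontrivial (V.baseChange S).carrier) : Nontrivial V.carrier := by
  by_contra hn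
  rw [not_nontrivial_iff_subsingleton] at hn
  refine not_subsingleton (V.baseChange S).carrier
    (show Subsingleton (S ⊗[R] V.carrier) from inferInstance)

theorem nontrivial_baseChange (V : SuperModule.{u, v, w} 𝒜) [Module.Free R V.carrier]
    [Nontrivial V.carrier] [Nontrivial S] : Nontrivial (V.baseChange S).carrier :=
  show Nontrivial (S ⊗[R] V.carrier) from
    have : Nontrivial R := Module.nontrivial R V.carrier
    (Algebra.TensorProduct.basis S (Module.Free.chooseBasis R V.carrier)).repr.toEquiv.nontrivial

/-- If an `R`-linear endomorphism of a free module becomes a scalar after an injective base change,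
it is a scalar. -/
theorem exists_scalar_of_baseChange (V : SuperModule.{u, v, w} 𝒜) [Module.Free R V.carrier]
    [Nontrivial V.carrier] (hinj : Function.Injective (algebraMap R S))
    (f : V.carrier →ₗ[A] V.carrier) (c : S)
    (hc : ∀ x, V.toBaseChange S (f x) = c • V.toBaseChange S x) :
    ∃ d : R, ∀ x, f x = d • x := by
  have : Nontrivial R := Module.nontrivial R V.carrier
  let b := Module.Free.chooseBasis R V.carrier
  have : Nonempty (Module.Free.ChooseBasisIndex R V.carrier) := b.index_nonempty
  obtain ⟨i⟩ := this
  -- The coordinate functional at `b i`, extended to `S`, recovers `c` from `f (b i)`; so `c` is the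
  -- image of a coordinate in `R`.
  let g : S ⊗[R] V.carrier →ₗ[S] S :=
    (TensorProduct.AlgebraTensorModule.rid R S S).toLinearMap ∘ₗ (b.coord i).baseChange S
  have hg : ∀ x, g (V.toBaseChange S x) = algebraMap R S (b.coord i x) := fun x => by
    simp [g, toBaseChange_apply, Algebra.algebraMap_eq_smul_one]
  have h1 : algebraMap R S (b.coord i (f (b i))) = c := by
    rw [← hg, hc]
    refine (map_smul g c _).trans ?_
    rw [hg]; simp
  refine ⟨b.coord i (f (b i)), fun x => V.toBaseChange_injective hinj ?_⟩
  rw [hc, toBaseChange_smul_base, h1]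

end BaseChangeMaps

end SuperModule

namespace SuperModule

/-! ### Generators, and scalar even endomorphisms over a field -/

section Field

variable {K : Type u} {A : Type v} [Field K] [Ring A] [Algebra K A]
  {𝒜 : ZMod 2 → Submodule K A}

theorem isGraded_span_singleton {R : Type u} {A : Type v} [CommRing R] [Ring A] [Algebra R A]
    {𝒜 : ZMod 2 → Submodule R A} (hA : Spans 𝒜) (V : SuperModule.{u, v, w} 𝒜) {j : ZMod 2}
    {x : V.carrier} (hx : x ∈ V.grading j) : V.IsGraded (Submodule.span A {x}) := by
  have key : ∀ {k : ZMod 2} {y : V.carrier} (i : ZMod 2), y ∈ V.grading k →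
      y ∈ Submodule.span A {x} → V.proj i y ∈ Submodule.span A {x} := by
    intro k y i hy hyN
    by_cases hik : i = k
    · subst hik; rwa [V.proj_of_mem hy]
    · rw [V.proj_of_mem_of_ne hik hy]; exact Submodule.zero_mem _
  rw [isGraded_iff]
  intro i y hy
  obtain ⟨a, rfl⟩ := Submodule.mem_span_singleton.1 hy
  obtain ⟨b, hb, c, hc, rfl⟩ := hA a
  have hxN : x ∈ Submodule.span A {x} := Submodule.mem_span_singleton_self x
  rw [add_smul, map_add]
  exact Submodule.add_mem _ (key i (V.smul_mem hb hx) (Submodule.smul_mem _ _ hxN))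
    (key i (V.smul_mem hc hx) (Submodule.smul_mem _ _ hxN))

theorem exists_homogeneous_ne_zero {R : Type u} {A : Type v} [CommRing R] [Ring A] [Algebra R A]
    {𝒜 : ZMod 2 → Submodule R A} (V : SuperModule.{u, v, w} 𝒜) [Nontrivial V.carrier] :
    ∃ j, ∃ x ∈ V.grading j, x ≠ 0 := by
  obtain ⟨x, hx⟩ := exists_ne (0 : V.carrier)
  by_cases h : V.proj 0 x = 0
  · refine ⟨1, _, V.proj_mem 1 x, fun h1 => hx ?_⟩
    rw [← V.proj_zero_add_proj_one x, h, h1, add_zero]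
  · exact ⟨0, _, V.proj_mem 0 x, h⟩

theorem IsSimple.exists_generator {R : Type u} {A : Type v} [CommRing R] [Ring A] [Algebra R A]
    {𝒜 : ZMod 2 → Submodule R A} {V : SuperModule.{u, v, w} 𝒜} (hA : Spans 𝒜)
    (hV : V.IsSimple) : ∃ j, ∃ x ∈ V.grading j, Submodule.span A {x} = ⊤ := by
  have := hV.1
  obtain ⟨j, x, hx, h0⟩ := V.exists_homogeneous_ne_zero
  refine ⟨j, x, hx, (hV.eq_bot_or_eq_top (V.isGraded_span_singleton hA hx)).resolve_left ?_⟩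
  rwa [Submodule.span_singleton_eq_bot]

theorem IsSimple.finite {V : SuperModule.{u, v, w} 𝒜} (hA : Spans 𝒜) [Module.Finite K A]
    (hV : V.IsSimple) : Module.Finite K V.carrier := by
  obtain ⟨j, x, -, h⟩ := hV.exists_generator hA
  have : Module.Finite A V.carrier := ⟨⟨{x}, by simpa using h⟩⟩
  exact Module.Finite.trans A V.carrier

/-- Schur's lemma over an algebraically closed field, in the form of an eigenvalue argument. -/
theorem IsSimple.hasScalarEvenEnds_of_isAlgClosed [IsAlgClosed K]
    {V : SuperModule.{u, v, w} 𝒜} [Module.Finite K V.carrier] (hV : V.IsSimple) :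
    HasScalarEvenEnds V := by
  intro f hf
  have := hV.1
  obtain ⟨c, hc⟩ := Module.End.exists_eigenvalue (K := K) (f.restrictScalars K)
  obtain ⟨x, hx⟩ := hc.exists_hasEigenvector
  let g : V.carrier →ₗ[A] V.carrier := f - c • LinearMap.id
  have hg : IsHomogeneous V V 0 g := fun i y hy =>
    Submodule.sub_mem _ (hf i y hy) (Submodule.smul_mem _ c (by simpa using hy))
  refine ⟨c, fun y => ?_⟩
  have htop : LinearMap.ker g = ⊤ := by
    refine (hV.eq_bot_or_eq_top hg.isGraded_ker).resolve_left fun h => hx.2 ?_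
    have hxk : x ∈ LinearMap.ker g := by
      rw [LinearMap.mem_ker]
      exact sub_eq_zero.2 hx.apply_eq_smul
    rwa [h] at hxk
  have hy : g y = 0 := LinearMap.mem_ker.1 (htop ▸ Submodule.mem_top)
  exact sub_eq_zero.1 hy

/-- Splitness keeps `V` simple over the algebraic closure, where an even endomorphism has an
eigenvalue and hence is a scalar. That scalar descends to `K` because it appears as a matrix
coefficient. -/
theorem IsSplit.hasScalarEvenEnds (hA : Spans 𝒜) [Module.Finite K A] (hs : IsSplit 𝒜)
    {V : SuperModule.{u, v, max u v} 𝒜} (hV : V.IsSimple) : HasScalarEvenEnds V := by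
  intro f hf
  have := hV.1
  have := hV.finite hA
  have : Module.Finite (AlgebraicClosure K) (V.baseChange (AlgebraicClosure K)).carrier :=
    show Module.Finite (AlgebraicClosure K) (AlgebraicClosure K ⊗[K] V.carrier) from inferInstance
  obtain ⟨c, hc⟩ := (hs V hV (AlgebraicClosure K)).hasScalarEvenEnds_of_isAlgClosed
    (baseChangeMap (AlgebraicClosure K) f) hf.baseChange
  exact V.exists_scalar_of_baseChange (algebraMap K (AlgebraicClosure K)).injective f c
    fun x => by rw [← hc, baseChangeMap_toBaseChange]

end Field

/-! ### Passing between lattices and their generic fibres -/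

section FractionField

variable {O : Type u} {A : Type v} [CommRing O] [Ring A] [Algebra O A]
  {𝒜 : ZMod 2 → Submodule O A}

theorem mem_grading_of_toBaseChange_mem {S : Type u'} [CommRing S] [Algebra O S]
    {V : SuperModule.{u, v, w} 𝒜} (h : Function.Injective (V.toBaseChange S)) {i : ZMod 2}
    {x : V.carrier} (hx : V.toBaseChange S x ∈ (V.baseChange S).grading i) :
    x ∈ V.grading i := by
  have h1 := proj_of_mem _ hx
  rw [proj_toBaseChange] at h1
  rw [← h h1]
  exact V.proj_mem i x

variable {F : Type u} [Field F] [Algebra O F] [IsFractionRing O F]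

theorem exists_clear_denominators [IsDomain O] (V : SuperModule.{u, v, w} 𝒜) {ι : Type*} [Finite ι]
    (z : ι → (V.baseChange F).carrier) :
    ∃ s : O, s ≠ 0 ∧ ∀ i, ∃ y, algebraMap O F s • z i = V.toBaseChange F y := by
  obtain ⟨s, hs⟩ := IsLocalizedModule.exist_integer_multiples_of_finite (nonZeroDivisors O)
    (TensorProduct.mk O F V.carrier 1) z
  refine ⟨s, nonZeroDivisors.ne_zero s.2, fun i => ?_⟩
  obtain ⟨y, hy⟩ := hs i
  refine ⟨y, ?_⟩
  rw [toBaseChange_apply]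
  refine Eq.trans ?_ hy.symm
  exact algebraMap_smul F (s : O) (show F ⊗[O] V.carrier from z i)

/-- A common denominator `s` for the images of a finite basis makes `s g` preserve the lattices.
Linearity and degree can then be checked in the generic fibre, into which `L'` embeds. -/
theorem exists_hom_of_baseChange_hom [IsDomain O] {L L' : SuperModule.{u, v, w} 𝒜} [Module.Free O L.carrier]
    [Module.Finite O L.carrier] [Module.Free O L'.carrier] {p : ZMod 2}
    {g : (L.baseChange F).carrier →ₗ[F ⊗[O] A] (L'.baseChange F).carrier}
    (hg : IsHomogeneous (L.baseChange F) (L'.baseChange F) p g) (h0 : g ≠ 0) :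
    ∃ f : L.carrier →ₗ[A] L'.carrier, IsHomogeneous L L' p f ∧ f ≠ 0 := by
  let b := Module.Free.chooseBasis O L.carrier
  obtain ⟨s, hs0, hs⟩ := exists_clear_denominators L'
    (fun i => g (L.toBaseChange F (b i)))
  choose y hy using hs
  have hinj := L'.toBaseChange_injective (IsFractionRing.injective O F)
  let f₀ : L.carrier →ₗ[O] L'.carrier := b.constr O y
  have hf₀ : ∀ x, L'.toBaseChange F (f₀ x) = algebraMap O F s • g (L.toBaseChange F x) := by
    intro x
    rw [← b.sum_repr x]
    simp only [map_sum, map_smul, toBaseChange_smul_base, map_smul_base, Finset.smul_sum]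
    refine Finset.sum_congr rfl fun i _ => ?_
    rw [smul_comm, hy, Module.Basis.constr_basis]
  let f : L.carrier →ₗ[A] L'.carrier :=
    { f₀ with
      map_smul' := fun a x => hinj (by
        change L'.toBaseChange F (f₀ (a • x)) = L'.toBaseChange F (a • f₀ x)
        rw [hf₀, toBaseChange_smul, toBaseChange_smul, hf₀, map_smul, smul_algebra_smul_comm]) }
  have hf : ∀ x, L'.toBaseChange F (f x) = algebraMap O F s • g (L.toBaseChange F x) := hf₀
  refine ⟨f, fun i x hx => mem_grading_of_toBaseChange_mem hinj ?_, fun hf0 => h0 ?_⟩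
  · rw [hf]
    exact Submodule.smul_mem _ _ (hg i _ (L.toBaseChange_mem hx))
  · refine baseChange_hom_ext fun x => ?_
    have h1 := hf x
    rw [hf0, LinearMap.zero_apply, map_zero] at h1
    refine (smul_eq_zero.1 h1.symm).resolve_left ?_
    simpa using hs0

theorem baseChangeMap_ne_zero {L L' : SuperModule.{u, v, w} 𝒜} [Module.Free O L'.carrier]
    {f : L.carrier →ₗ[A] L'.carrier} (h0 : f ≠ 0) : baseChangeMap F f ≠ 0 := by
  refine fun h => h0 (LinearMap.ext fun x =>
    L'.toBaseChange_injective (IsFractionRing.injective O F) ?_)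
  rw [← baseChangeMap_toBaseChange, h]
  simp

end FractionField

end SuperModule

/-! ### Derivations are inner, and homomorphisms of lattices lift -/

section Lifting

open IsLocalRing

variable {O : Type u} [CommRing O] {A : Type v} [Ring A] [Algebra O A]

/-- An invariant subspace has an invariant complement if the acting algebra is semisimple. -/
theorem exists_invariant_isCompl {k : Type*} [Field k] [Algebra O k]
    [IsSemisimpleRing (k ⊗[O] A)] {X : Type*} [AddCommGroup X] [Module k X] [Module O X]
    [IsScalarTower O k X] (φ : A →ₐ[O] Module.End k X) (p : Submodule k X)
    (hp : ∀ a, ∀ x ∈ p, φ a x ∈ p) :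
    ∃ q : Submodule k X, IsCompl p q ∧ ∀ a, ∀ x ∈ q, φ a x ∈ q := by
  let Φ : k ⊗[O] A →ₐ[k] Module.End k X := AlgHom.liftEquiv O k A _ φ
  have hΦ : ∀ (c : k) (a : A) (x : X), Φ (c ⊗ₜ a) x = c • φ a x := fun c a x => by
    simp [Φ]
  let : Module (k ⊗[O] A) X := Module.compHom X Φ.toRingHom
  have hsm : ∀ (b : k ⊗[O] A) (x : X), b • x = Φ b x := fun _ _ => rfl
  let p' : Submodule (k ⊗[O] A) X :=
    { p with
      smul_mem' := fun b x hx => by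
        change b • x ∈ p
        rw [hsm]
        induction b using TensorProduct.induction_on with
        | zero => simp
        | tmul c a => rw [hΦ]; exact p.smul_mem c (hp a x hx)
        | add b c hb hc => rw [map_add, LinearMap.add_apply]; exact p.add_mem hb hc }
  obtain ⟨q', hq'⟩ := exists_isCompl p'
  -- The complement is found as a `k ⊗ A`-submodule; it is a `k`-subspace because `c ⊗ 1` acts as
  -- the scalar `c`.
  let q : Submodule k X :=
    { q' with
      smul_mem' := fun c x hx => by
        have := q'.smul_mem (c ⊗ₜ[O] (1 : A)) hx
        rw [hsm, hΦ, map_one] at this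
        exact this }
  refine ⟨q, ⟨?_, ?_⟩, fun a x hx => ?_⟩
  · rw [Submodule.disjoint_def]
    intro x hx hx'
    exact Submodule.disjoint_def.1 hq'.disjoint x hx hx'
  · rw [codisjoint_iff, Submodule.eq_top_iff']
    intro x
    have hx : x ∈ p' ⊔ q' := by rw [hq'.sup_eq_top]; trivial
    obtain ⟨y, hy, z, hz, h⟩ := Submodule.mem_sup.1 hx
    exact Submodule.mem_sup.2 ⟨y, hy, z, hz, h⟩
  · have := q'.smul_mem ((1 : k) ⊗ₜ[O] a) hx
    rwa [hsm, hΦ, one_smul] at this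

variable {L L' : Type*} [AddCommGroup L] [Module O L] [Module A L]
  [AddCommGroup L'] [Module O L'] [Module A L'] [IsScalarTower O A L']

variable (O A L L') in
/-- The derivations of `A` with values in the bimodule of `O`-linear maps `L → L'`. -/
def homDerivations : Submodule O (A →ₗ[O] L →ₗ[O] L') where
  carrier := {d | ∀ a b x, d (a * b) x = a • d b x + d a (b • x)}
  zero_mem' := fun a b x => by simp
  add_mem' := fun {d e} hd he a b x => by
    simp only [LinearMap.add_apply, hd a b x, he a b x, smul_add]
    abel
  smul_mem' := fun r d hd a b x => by
    simp only [LinearMap.smul_apply, hd a b x, smul_add, smul_algebra_smul_comm]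

/-- The derivations form a saturated submodule of all maps, so dividing one by `ϖ` stays among them.
-/
theorem mem_homDerivations_of_smul_mem {r : O} (hr : Function.Injective fun y : L' => r • y)
    {d : A →ₗ[O] L →ₗ[O] L'} (hd : r • d ∈ homDerivations O A L L') :
    d ∈ homDerivations O A L L' := fun a b x => hr <| by
  have := hd a b x
  simp only [LinearMap.smul_apply] at this
  simp only [this, smul_add, smul_algebra_smul_comm]

variable [IsScalarTower O A L]

variable (O A L L') in
/-- The inner derivation `a ↦ a f - f a` attached to an `O`-linear map `f`. -/
def innerHomDerivation : (L →ₗ[O] L') →ₗ[O] A →ₗ[O] L →ₗ[O] L' where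
  toFun f :=
    { toFun := fun a => Algebra.lsmul O O L' a ∘ₗ f - f ∘ₗ Algebra.lsmul O O L a
      map_add' := fun a b => by ext x; simp; abel
      map_smul' := fun r a => by ext x; simp [smul_sub] }
  map_add' f g := by ext a x; simp; abel
  map_smul' r f := by ext a x; simp [smul_sub, smul_algebra_smul_comm]

theorem innerHomDerivation_apply (f : L →ₗ[O] L') (a : A) (x : L) :
    innerHomDerivation O A L L' f a x = a • f x - f (a • x) := rfl

theorem innerHomDerivation_mem (f : L →ₗ[O] L') :
    innerHomDerivation O A L L' f ∈ homDerivations O A L L' := fun a b x => by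
  simp only [innerHomDerivation_apply, smul_sub, mul_smul]
  abel

theorem LinearMap.exists_eq_smul {M N : Type*} [AddCommGroup M] [Module O M] [AddCommGroup N]
    [Module O N] {r : O} (hr : Function.Injective fun y : N => r • y) (f : M →ₗ[O] N)
    (h : ∀ x, ∃ y, f x = r • y) : ∃ g : M →ₗ[O] N, f = r • g := by
  choose g hg using h
  refine ⟨{ toFun := g, map_add' := fun x y => hr ?_, map_smul' := fun c x => hr ?_ },
    LinearMap.ext hg⟩
  · change r • g (x + y) = r • (g x + g y)
    rw [smul_add, ← hg, ← hg, ← hg, map_add]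
  · change r • g (c • x) = r • c • g x
    rw [smul_comm r c, ← hg, ← hg, map_smul]

variable [IsLocalRing O]

theorem exists_lift_residueField [Module.Free O L] (h : ResidueField O ⊗[O] L →ₗ[ResidueField O]
    ResidueField O ⊗[O] L') :
    ∃ f : L →ₗ[O] L', ∀ x, (1 : ResidueField O) ⊗ₜ[O] f x = h (1 ⊗ₜ x) := by
  have hsurj : Function.Surjective (TensorProduct.mk O (ResidueField O) L' 1) :=
    TensorProduct.mk_surjective O L' (ResidueField O) residue_surjective
  obtain ⟨f, hf⟩ := Module.projective_lifting_property (TensorProduct.mk O (ResidueField O) L' 1)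
    (h.restrictScalars O ∘ₗ TensorProduct.mk O (ResidueField O) L 1) hsurj
  exact ⟨f, fun x => LinearMap.congr_fun hf x⟩

/-- In a basis, each coordinate dies in the residue field and is therefore a multiple of `ϖ`. -/
theorem exists_smul_of_one_tmul_eq_zero [Module.Free O L] {ϖ : O}
    (hϖ : maximalIdeal O = Ideal.span {ϖ}) {y : L} (hy : (1 : ResidueField O) ⊗ₜ[O] y = 0) :
    ∃ z, y = ϖ • z := by
  let b := Module.Free.chooseBasis O L
  have h : ∀ i, ∃ c, b.repr y i = ϖ * c := fun i => by
    have h1 := congrArg (fun z => (Algebra.TensorProduct.basis (ResidueField O) b).repr z i) hy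
    simp only [Algebra.TensorProduct.basis_repr_tmul, map_zero, Finsupp.zero_apply,
      Finsupp.mapRange_apply, one_smul] at h1
    have h2 : b.repr y i ∈ maximalIdeal O := (residue_eq_zero_iff _).1 h1
    rw [hϖ, Ideal.mem_span_singleton] at h2
    exact h2
  choose c hc using h
  refine ⟨(b.repr y).sum fun i _ => c i • b i, ?_⟩
  conv_lhs => rw [← b.linearCombination_repr y]
  rw [Finsupp.linearCombination_apply, Finsupp.smul_sum]
  refine Finsupp.sum_congr fun i _ => ?_
  rw [hc, mul_smul]

theorem exists_eq_smul_of_one_tmul_eq_zero {P M N : Type*} [AddCommGroup P] [Module O P]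
    [AddCommGroup M] [Module O M] [AddCommGroup N] [Module O N] [Module.Free O N] {ϖ : O}
    (hϖ : maximalIdeal O = Ideal.span {ϖ}) (hinj : Function.Injective fun y : N => ϖ • y)
    (d : P →ₗ[O] M →ₗ[O] N) (hd : ∀ a x, (1 : ResidueField O) ⊗ₜ[O] d a x = 0) :
    ∃ e : P →ₗ[O] M →ₗ[O] N, d = ϖ • e := by
  refine LinearMap.exists_eq_smul (fun f g h => LinearMap.ext fun x => hinj ?_) d fun a =>
    LinearMap.exists_eq_smul hinj (d a) fun x => exists_smul_of_one_tmul_eq_zero hϖ (hd a x)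
  exact LinearMap.congr_fun h x

section Semisimple

variable [IsSemisimpleRing (ResidueField O ⊗[O] A)]

/-- Modulo the maximal ideal, every derivation is inner. -/
theorem exists_inner_of_mem_homDerivations [Module.Free O L] {d : A →ₗ[O] L →ₗ[O] L'}
    (hd : d ∈ homDerivations O A L L') :
    ∃ f : L →ₗ[O] L', ∀ a x,
      (1 : ResidueField O) ⊗ₜ[O] (d a x - innerHomDerivation O A L L' f a x) = 0 := by
  let k := ResidueField O
  let X := (k ⊗[O] L') × (k ⊗[O] L)
  let α : A → Module.End k (k ⊗[O] L') := fun a => (Algebra.lsmul O O L' a).baseChange k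
  let β : A → Module.End k (k ⊗[O] L) := fun a => (Algebra.lsmul O O L a).baseChange k
  let δ : A → (k ⊗[O] L →ₗ[k] k ⊗[O] L') := fun a => (d a).baseChange k
  have hd1 : d 1 = 0 := LinearMap.ext fun x => by
    have := hd 1 1 x
    simpa using this
  have hα : ∀ a b, α (a * b) = α a ∘ₗ α b := fun a b => by ext; simp [α]
  have hβ : ∀ a b, β (a * b) = β a ∘ₗ β b := fun a b => by ext; simp [β]
  have hδ : ∀ a b, δ (a * b) = α a ∘ₗ δ b + δ a ∘ₗ β b := fun a b => by
    ext x; simp [α, β, δ, hd a b, TensorProduct.tmul_add]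
  -- The derivation is read as an extension: `a` acts by the block matrix with rows `(α a, δ a)` and
  -- `(0, β a)`. Multiplicativity of the upper right corner is the Leibniz rule.
  let φ : A →ₐ[O] Module.End k X := AlgHom.ofLinearMap
    { toFun := fun a => ((α a).coprod (δ a)).prod (β a ∘ₗ LinearMap.snd k _ _)
      map_add' := fun a b => by
        ext <;> simp [α, β, δ]
      map_smul' := fun r a => by
        ext <;> simp [α, β, δ] }
    (by
      have h1 : α 1 = LinearMap.id := by ext; simp [α]
      have h2 : β 1 = LinearMap.id := by ext; simp [β]
      have h3 : δ 1 = 0 := by ext; simp [δ, hd1]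
      refine LinearMap.ext fun x => ?_
      change (α 1 x.1 + δ 1 x.2, β 1 x.2) = x
      rw [h1, h2, h3]; simp)
    (fun a b => by
      refine LinearMap.ext fun x => ?_
      change (α (a * b) x.1 + δ (a * b) x.2, β (a * b) x.2) =
        (α a (α b x.1 + δ b x.2) + δ a (β b x.2), β a (β b x.2))
      rw [hα, hβ, hδ, map_add]
      simp only [LinearMap.comp_apply, LinearMap.add_apply, add_assoc])
  have hφ : ∀ a x, φ a x = (α a x.1 + δ a x.2, β a x.2) := fun _ _ => rfl
  -- The vectors with second component zero form an invariant copy of `k ⊗ L'`. An invariant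
  -- complement `q` is the graph `{(-h z, z)}`, where `h` is the projection along `q` restricted to
  -- `k ⊗ L`.
  obtain ⟨q, hq, hqφ⟩ := exists_invariant_isCompl φ
    (LinearMap.ker (LinearMap.snd k (k ⊗[O] L') (k ⊗[O] L))) (fun a x hx => by
      rw [LinearMap.mem_ker, LinearMap.snd_apply] at hx ⊢
      rw [hφ, hx, map_zero, map_zero])
  let h : k ⊗[O] L →ₗ[k] k ⊗[O] L' :=
    LinearMap.fst k _ _ ∘ₗ Submodule.projection _ _ hq ∘ₗ LinearMap.inr k _ _
  have hmem : ∀ z, (-h z, z) ∈ q := fun z => by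
    rw [← Submodule.projection_apply_eq_zero_iff hq]
    have h1 : ((-h z, z) : X) = (0, z) - Submodule.projection _ _ hq (0, z) := by
      have h2 : (Submodule.projection _ _ hq ((0, z) : X)).2 = 0 :=
        LinearMap.mem_ker.1 (Submodule.projection_apply_mem hq (0, z))
      refine Prod.ext ?_ ?_
      · exact (zero_sub _).symm
      · exact ((congrArg (z - ·) h2).trans (sub_zero z)).symm
    rw [h1, map_sub, sub_eq_zero]
    exact (Submodule.projection_apply_left hq ⟨_, Submodule.projection_apply_mem hq _⟩).symm
  have huniq : ∀ y z, (y, z) ∈ q → y = -h z := fun y z hyz => by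
    have h1 : ((y, z) : X) - (-h z, z) = 0 :=
      Submodule.disjoint_def.1 hq.disjoint _ (sub_self z) (q.sub_mem hyz (hmem z))
    exact sub_eq_zero.1 (congrArg Prod.fst h1)
  obtain ⟨f, hf⟩ := exists_lift_residueField h
  refine ⟨f, fun a x => ?_⟩
  -- Invariance of the graph says `δ z - α (h z) = -h (β z)`, that is, `δ = α h - h β`: the reduced
  -- derivation is the inner one given by `h`.
  have h1 := hqφ a _ (hmem (1 ⊗ₜ x))
  rw [hφ] at h1
  have h2 := huniq _ _ h1
  simp only [map_neg, ← hf, α, β, δ, LinearMap.baseChange_tmul, Algebra.lsmul_coe] at h2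
  rw [← sub_eq_zero] at h2
  rw [innerHomDerivation_apply, TensorProduct.tmul_sub, TensorProduct.tmul_sub, ← h2]
  abel

/-- Every derivation is inner. -/
theorem homDerivations_le_range [IsNoetherianRing O] [IsDomain O] [Module.Free O L]
    [Module.Finite O L] [Module.Free O L'] [Module.Finite O L'] [Module.Finite O A] {ϖ : O}
    (hϖ : maximalIdeal O = Ideal.span {ϖ}) (hϖ0 : ϖ ≠ 0) :
    homDerivations O A L L' ≤ LinearMap.range (innerHomDerivation O A L L') := by
  have hinj : Function.Injective fun y : L' => ϖ • y := smul_right_injective L' hϖ0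
  have hfg : (homDerivations O A L L').FG := IsNoetherian.noetherian _
  -- Nakayama: it suffices to write a derivation as an inner one plus an element of the maximal
  -- ideal times derivations. The difference from an inner derivation that agrees with it modulo `ϖ`
  -- is `ϖ e`, and `e` is a derivation by saturation.
  refine Submodule.le_of_le_smul_of_le_jacobson_bot hfg
    (maximalIdeal_le_jacobson ⊥) fun d hd => ?_
  obtain ⟨f, hf⟩ := exists_inner_of_mem_homDerivations hd
  obtain ⟨e, he⟩ := exists_eq_smul_of_one_tmul_eq_zero hϖ hinj
    (d - innerHomDerivation O A L L' f) hf
  have heD := mem_homDerivations_of_smul_mem hinj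
    (he ▸ Submodule.sub_mem _ hd (innerHomDerivation_mem f))
  rw [← sub_add_cancel d (innerHomDerivation O A L L' f), add_comm, he]
  refine Submodule.add_mem_sup ⟨f, rfl⟩ (Submodule.smul_mem_smul ?_ heD)
  rw [hϖ]
  exact Ideal.mem_span_singleton_self ϖ

/-- Homomorphisms between lattices lift from the semisimple reduction. -/
theorem exists_linearMap_lift [IsNoetherianRing O] [IsDomain O] [Module.Free O L]
    [Module.Finite O L] [Module.Free O L'] [Module.Finite O L'] [Module.Finite O A] {ϖ : O}
    (hϖ : maximalIdeal O = Ideal.span {ϖ}) (hϖ0 : ϖ ≠ 0)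
    (h : ResidueField O ⊗[O] L →ₗ[ResidueField O] ResidueField O ⊗[O] L')
    (hA : ∀ (a : A) (x : L),
      h (1 ⊗ₜ (a • x)) = (Algebra.lsmul O O L' a).baseChange (ResidueField O) (h (1 ⊗ₜ x))) :
    ∃ f : L →ₗ[A] L', ∀ x, (1 : ResidueField O) ⊗ₜ[O] f x = h (1 ⊗ₜ x) := by
  have hinj : Function.Injective fun y : L' => ϖ • y := smul_right_injective L' hϖ0
  obtain ⟨f, hf⟩ := exists_lift_residueField h
  -- The failure of `f` to be `A`-linear vanishes modulo `ϖ`, so it is `ϖ d` with `d` a derivation.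
  -- Writing `d` as inner through `g`, the map `f - ϖ g` is `A`-linear with the same reduction as
  -- `f`.
  obtain ⟨d, hd⟩ := exists_eq_smul_of_one_tmul_eq_zero hϖ hinj
    (innerHomDerivation O A L L' f) fun a x => by
      rw [innerHomDerivation_apply, TensorProduct.tmul_sub, hf, hA, ← hf,
        LinearMap.baseChange_tmul, Algebra.lsmul_coe, sub_self]
  obtain ⟨g, rfl⟩ := homDerivations_le_range hϖ hϖ0
    (mem_homDerivations_of_smul_mem hinj (hd ▸ innerHomDerivation_mem f))
  refine ⟨{ f - ϖ • g with map_smul' := fun a x => ?_ }, fun x => ?_⟩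
  · have h1 := LinearMap.congr_fun (LinearMap.congr_fun hd a) x
    simp only [LinearMap.smul_apply, innerHomDerivation_apply, smul_sub] at h1
    change f (a • x) - ϖ • g (a • x) = a • (f x - ϖ • g x)
    rw [smul_sub, smul_algebra_smul_comm, sub_eq_sub_iff_sub_eq_sub, ← neg_sub, h1, neg_sub]
  · change (1 : ResidueField O) ⊗ₜ[O] (f x - ϖ • g x) = _
    rw [TensorProduct.tmul_sub, hf, ← TensorProduct.smul_tmul]
    have : ϖ • (1 : ResidueField O) = 0 := by
      rw [Algebra.smul_def, mul_one]
      exact (residue_eq_zero_iff _).2 (hϖ ▸ Ideal.mem_span_singleton_self ϖ)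
    rw [this, TensorProduct.zero_tmul, sub_zero]

end Semisimple

end Lifting

namespace SuperModule

/-! ### Simplicity and isomorphisms under reduction -/

section Reduction

open IsLocalRing

variable {O : Type u} [CommRing O] {A : Type v} [Ring A] [Algebra O A]
  {𝒜 : ZMod 2 → Submodule O A} {p : ZMod 2}

/-- A supermodule over a semisimple algebra whose even endomorphisms are scalars is simple. -/
theorem HasScalarEvenEnds.isSimple {K : Type u} {B : Type v} [Field K] [Ring B] [Algebra K B]
    {ℬ : ZMod 2 → Submodule K B} (hB : Spans ℬ) [IsSemisimpleRing B]
    {V : SuperModule.{u, v, w} ℬ} [hn : Nontrivial V.carrier] (hV : HasScalarEvenEnds V) :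
    V.IsSimple := by
  refine ⟨hn, fun N hN => ?_⟩
  have hN' := (isGraded_iff V N).1 hN
  obtain ⟨N', hc⟩ := exists_isCompl N
  -- The complement need not be graded, so the projection need not be even. Its even component still
  -- maps into `N` and fixes the homogeneous elements of `N`, because `N` is graded. Being a scalar
  -- `c`, it forces `N = ⊤` when `c = 1` and `N = ⊥` otherwise.
  obtain ⟨g, hg, hgp⟩ := exists_component hB (Submodule.projection _ _ hc) 0
  obtain ⟨c, hcs⟩ := hV g hg
  have hgN : ∀ x, g x ∈ N := fun x => by
    rw [← V.proj_zero_add_proj_one x, map_add, hgp _ _ (V.proj_mem 0 x),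
      hgp _ _ (V.proj_mem 1 x)]
    exact N.add_mem (hN' _ _ (Submodule.projection_apply_mem hc _))
      (hN' _ _ (Submodule.projection_apply_mem hc _))
  have hgid : ∀ i, ∀ x ∈ N, V.proj i x ≠ 0 → c = 1 := fun i x hx h0 => by
    have h1 : g (V.proj i x) = V.proj i x := by
      rw [hgp _ _ (V.proj_mem i x),
        Submodule.projection_apply_left hc ⟨V.proj i x, hN' i x hx⟩, add_zero]
      exact V.proj_of_mem (V.proj_mem i x)
    rw [hcs] at h1
    by_contra hne
    have h2 : (c - 1) • V.proj i x = 0 := by rw [sub_smul, h1, one_smul, sub_self]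
    exact (smul_eq_zero.1 h2).elim (sub_ne_zero.2 hne) h0
  rcases eq_or_ne c 1 with rfl | hne
  · right
    rw [Submodule.eq_top_iff']
    intro x
    have := hgN x
    rwa [hcs, one_smul] at this
  · left
    rw [Submodule.eq_bot_iff]
    intro x hx
    have h : ∀ i, V.proj i x = 0 := fun i => by
      by_contra h0
      exact hne (hgid i x hx h0)
    rw [← V.proj_zero_add_proj_one x, h, h, add_zero]

variable [IsDomain O] [IsDiscreteValuationRing O]

theorem exists_uniformizer (O : Type u) [CommRing O] [IsDomain O] [IsDiscreteValuationRing O] :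
    ∃ ϖ : O, maximalIdeal O = Ideal.span {ϖ} ∧ ϖ ≠ 0 ∧ ¬ IsUnit ϖ := by
  obtain ⟨ϖ, h⟩ := IsDiscreteValuationRing.exists_irreducible O
  exact ⟨ϖ, h.maximalIdeal_eq, h.ne_zero, h.not_isUnit⟩

/-- After dividing by a power of the uniformizer, a homomorphism of lattices has non-zero
reduction. -/
theorem exists_hom_baseChangeMap_ne_zero {L L' : SuperModule.{u, v, w} 𝒜}
    [Module.Free O L'.carrier] {f : L.carrier →ₗ[A] L'.carrier}
    (hf : IsHomogeneous L L' p f) (h0 : f ≠ 0) :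
    ∃ f₁ : L.carrier →ₗ[A] L'.carrier, IsHomogeneous L L' p f₁ ∧
      baseChangeMap (ResidueField O) f₁ ≠ 0 := by
  obtain ⟨ϖ, hϖ, hϖ0, hϖu⟩ := exists_uniformizer O
  have hinj : Function.Injective fun y : L'.carrier => ϖ • y := smul_right_injective _ hϖ0
  let b := Module.Free.chooseBasis O L'.carrier
  obtain ⟨x, hx⟩ : ∃ x, f x ≠ 0 := by
    by_contra! h
    exact h0 (LinearMap.ext h)
  obtain ⟨i, hi⟩ : ∃ i, b.repr (f x) i ≠ 0 := by
    by_contra! h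
    exact hx (b.repr.map_eq_zero_iff.1 (Finsupp.ext h))
  -- One non-zero coordinate of one value `f x` bounds how often `f` can be divided by `ϖ`. The
  -- induction is on an exponent `m` such that `ϖ ^ m` does not divide this coordinate.
  obtain ⟨n, hn⟩ := FiniteMultiplicity.of_not_isUnit hϖu hi
  clear hx h0 hi
  generalize n + 1 = m at hn
  induction m generalizing f with
  | zero => exact (hn (by simp)).elim
  | succ m ih =>
    by_cases hred : baseChangeMap (ResidueField O) f = 0
    · have hdiv : ∀ y, ∃ z, f y = ϖ • z := fun y => by
        refine exists_smul_of_one_tmul_eq_zero hϖ ?_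
        have := baseChangeMap_toBaseChange (S := ResidueField O) f y
        rw [hred] at this
        exact this.symm
      choose f₁ hf₁ using hdiv
      let f₂ : L.carrier →ₗ[A] L'.carrier :=
        { toFun := f₁
          map_add' := fun y z => hinj (by
            change ϖ • f₁ (y + z) = ϖ • (f₁ y + f₁ z)
            rw [smul_add, ← hf₁, ← hf₁, ← hf₁, map_add])
          map_smul' := fun a y => hinj (by
            change ϖ • f₁ (a • y) = ϖ • a • f₁ y
            rw [← smul_algebra_smul_comm, ← hf₁, ← hf₁, map_smul]) }
      have hf₂ : ∀ y, f y = ϖ • f₂ y := hf₁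
      refine ih (f := f₂) (fun j y hy => ?_) fun hd => hn ?_
      · have h1 := hf j y hy
        rw [hf₂] at h1
        have h2 := L'.proj_of_mem h1
        rw [map_smul] at h2
        rw [← hinj h2]
        exact L'.proj_mem _ _
      · rw [hf₂, map_smul, Finsupp.smul_apply, smul_eq_mul, pow_succ']
        exact mul_dvd_mul_left ϖ hd
    · exact ⟨f, hf, hred⟩

variable {L L' : SuperModule.{u, v, w} 𝒜} [Module.Free O L.carrier] [Module.Finite O L.carrier]
  [Module.Free O L'.carrier] [Module.Finite O L'.carrier]

/-- Homogeneous homomorphisms between reductions of lattices lift. -/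
theorem exists_hom_baseChangeMap_eq (hA : Spans 𝒜) [Module.Finite O A]
    [IsSemisimpleRing (ResidueField O ⊗[O] A)]
    {g : (L.baseChange (ResidueField O)).carrier →ₗ[ResidueField O ⊗[O] A]
      (L'.baseChange (ResidueField O)).carrier}
    (hg : IsHomogeneous (L.baseChange (ResidueField O)) (L'.baseChange (ResidueField O)) p g) :
    ∃ f : L.carrier →ₗ[A] L'.carrier, IsHomogeneous L L' p f ∧
      baseChangeMap (ResidueField O) f = g := by
  obtain ⟨ϖ, hϖ, hϖ0, -⟩ := exists_uniformizer O
  let h : ResidueField O ⊗[O] L.carrier →ₗ[ResidueField O] ResidueField O ⊗[O] L'.carrier :=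
    g.restrictScalars (ResidueField O)
  have hh : ∀ x, h (1 ⊗ₜ x) = g (L.toBaseChange (ResidueField O) x) := fun _ => rfl
  obtain ⟨f₀, hf₀⟩ := exists_linearMap_lift hϖ hϖ0 h fun a x => by
    rw [hh, toBaseChange_smul, map_smul, ← hh]
    change L'.baseChangeAction (ResidueField O) (1 ⊗ₜ a) _ = _
    induction h (1 ⊗ₜ x) using TensorProduct.induction_on with
    | zero => simp
    | tmul s y => rw [baseChangeAction_tmul, one_mul]; simp
    | add y z hy hz => rw [map_add, map_add, hy, hz]
  have hf₀' : ∀ x, L'.toBaseChange (ResidueField O) (f₀ x) =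
      g (L.toBaseChange (ResidueField O) x) := hf₀
  -- The lift need not be homogeneous. Since `g` is, the component of degree `p` has the same
  -- reduction.
  obtain ⟨f, hf, hfp⟩ := exists_component hA f₀ p
  refine ⟨f, hf, baseChange_hom_ext fun x => ?_⟩
  rw [baseChangeMap_toBaseChange, ← L.proj_zero_add_proj_one x]
  have key : ∀ i, L'.toBaseChange (ResidueField O) (f (L.proj i x)) =
      g (L.toBaseChange (ResidueField O) (L.proj i x)) := fun i => by
    rw [hfp _ _ (L.proj_mem i x), ← proj_toBaseChange, hf₀']
    exact proj_of_mem _ (hg _ _ (L.toBaseChange_mem (L.proj_mem i x)))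
  rw [map_add, map_add, map_add, map_add, key, key]

variable {F : Type u} [Field F] [Algebra O F] [IsFractionRing O F]

/-- An even endomorphism of the reduction lifts to the lattice; the lift is a scalar over `F`, hence
already over `O`, and the scalar reduces. -/
theorem HasScalarEvenEnds.residueField (hA : Spans 𝒜) [Module.Finite O A]
    [IsSemisimpleRing (ResidueField O ⊗[O] A)] [Nontrivial L.carrier]
    (h : HasScalarEvenEnds (L.baseChange F)) :
    HasScalarEvenEnds (L.baseChange (ResidueField O)) := by
  intro g hg
  obtain ⟨f, hf, rfl⟩ := exists_hom_baseChangeMap_eq hA hg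
  obtain ⟨c, hc⟩ := h _ hf.baseChange
  obtain ⟨d, hd⟩ := L.exists_scalar_of_baseChange (IsFractionRing.injective O F) f c fun x => by
    rw [← hc, baseChangeMap_toBaseChange]
  refine ⟨algebraMap O _ d, fun y => ?_⟩
  induction y using baseChange_induction with
  | zero => rw [map_zero, smul_zero]
  | smul s x =>
    rw [map_smul_base, baseChangeMap_toBaseChange, hd, toBaseChange_smul_base, smul_comm]
  | add y z hy hz => rw [map_add, hy, hz, smul_add]

theorem isSimple_residueField (hA : Spans 𝒜) [Module.Finite O A]
    [IsSemisimpleRing (ResidueField O ⊗[O] A)] (hL : (L.baseChange F).IsSimple)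
    (h : HasScalarEvenEnds (L.baseChange F)) :
    (L.baseChange (ResidueField O)).IsSimple := by
  have := nontrivial_of_nontrivial_baseChange hL.1
  have := nontrivial_baseChange (S := ResidueField O) L
  exact (h.residueField hA).isSimple (hA.baseChange _)

/-- By Schur's lemma non-zero homogeneous maps suffice on both sides. Lifting gives one direction;
clearing denominators and then dividing by the largest possible power of `ϖ` gives the other. -/
theorem isoOfParity_residueField_iff (hA : Spans 𝒜) [Module.Finite O A]
    [IsSemisimpleRing (ResidueField O ⊗[O] A)] (hL : (L.baseChange F).IsSimple)
    (h : HasScalarEvenEnds (L.baseChange F)) (hL' : (L'.baseChange F).IsSimple)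
    (h' : HasScalarEvenEnds (L'.baseChange F)) :
    IsoOfParity (L.baseChange (ResidueField O)) (L'.baseChange (ResidueField O)) p ↔
      IsoOfParity (L.baseChange F) (L'.baseChange F) p := by
  have hk := isSimple_residueField hA hL h
  have hk' := isSimple_residueField hA hL' h'
  constructor
  · rintro ⟨e, he⟩
    obtain ⟨f, hf, hfe⟩ := exists_hom_baseChangeMap_eq hA he
    refine (hf.baseChange (S := F)).isoOfParity hL hL' (baseChangeMap_ne_zero ?_)
    rintro rfl
    have := hk.1
    obtain ⟨x, hx⟩ := exists_ne (0 : (L.baseChange (ResidueField O)).carrier)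
    refine hx (e.map_eq_zero_iff.1 ?_)
    have h1 : baseChangeMap (ResidueField O) (0 : L.carrier →ₗ[A] L'.carrier) = 0 :=
      baseChange_hom_ext fun x => by rw [baseChangeMap_toBaseChange]; simp
    rw [← LinearEquiv.coe_coe, ← hfe, h1, LinearMap.zero_apply]
  · rintro ⟨e, he⟩
    have := hL.1
    have he0 : e.toLinearMap ≠ 0 := fun h0 => by
      obtain ⟨x, hx⟩ := exists_ne (0 : (L.baseChange F).carrier)
      exact hx (e.map_eq_zero_iff.1 (LinearMap.congr_fun h0 x))
    obtain ⟨f, hf, hf0⟩ := exists_hom_of_baseChange_hom he he0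
    obtain ⟨f₁, hf₁, h1⟩ := exists_hom_baseChangeMap_ne_zero hf hf0
    exact (hf₁.baseChange (S := ResidueField O)).isoOfParity hk hk' h1

end Reduction

end SuperModule

namespace SuperModule

/-! ### Submodules, quotients and regular supermodules -/

section Constructions

variable {R : Type u} {A : Type v} [CommRing R] [Ring A] [Algebra R A]
  {𝒜 : ZMod 2 → Submodule R A}

theorem isInternal_of_isCompl {M : Type*} [AddCommGroup M] [Module R M]
    {G : ZMod 2 → Submodule R M} (h : IsCompl (G 0) (G 1)) : DirectSum.IsInternal G :=
  (DirectSum.isInternal_submodule_iff_isCompl G (i := 0) (j := 1) (by decide) (by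
    ext j; rcases two_eq_zero_or_one j with rfl | rfl <;> simp)).2 h

/-- A graded submodule as a supermodule. -/
def ofSubmodule (V : SuperModule.{u, v, w} 𝒜) (N : Submodule A V.carrier) (hN : V.IsGraded N) :
    SuperModule.{u, v, w} 𝒜 where
  carrier := N
  grading i := (V.grading i).comap (N.subtype.restrictScalars R)
  isInternal := isInternal_of_isCompl <| by
    constructor
    · rw [Submodule.disjoint_def]
      intro x h0 h1
      exact Subtype.ext (V.eq_zero_of_mem (i := 0) h0 h1)
    · rw [codisjoint_iff, Submodule.eq_top_iff']
      intro x
      have h := (isGraded_iff V N).1 hN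
      refine Submodule.mem_sup.2 ⟨⟨V.proj 0 x, h 0 x x.2⟩, V.proj_mem 0 _,
        ⟨V.proj 1 x, h 1 x x.2⟩, V.proj_mem 1 _, Subtype.ext (V.proj_zero_add_proj_one x)⟩
  smul_mem := fun ha hx => V.smul_mem ha hx

/-- The inclusion of a graded submodule. -/
def inclusion (V : SuperModule.{u, v, w} 𝒜) (N : Submodule A V.carrier) (hN : V.IsGraded N) :
    (V.ofSubmodule N hN).carrier →ₗ[A] V.carrier := N.subtype

theorem inclusion_isHomogeneous (V : SuperModule.{u, v, w} 𝒜) (N : Submodule A V.carrier)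
    (hN : V.IsGraded N) : IsHomogeneous (V.ofSubmodule N hN) V 0 (V.inclusion N hN) :=
  fun i x hx => by rw [add_zero]; exact hx

/-- The quotient by a graded submodule. -/
def quotient (V : SuperModule.{u, v, w} 𝒜) (N : Submodule A V.carrier) (hN : V.IsGraded N) :
    SuperModule.{u, v, w} 𝒜 where
  carrier := V.carrier ⧸ N
  grading i := (V.grading i).map (N.mkQ.restrictScalars R)
  isInternal := isInternal_of_isCompl <| by
    constructor
    · rw [Submodule.disjoint_def]
      rintro _ ⟨y, hy, rfl⟩ ⟨z, hz, hyz⟩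
      have h : z - y ∈ N := (Submodule.Quotient.eq N).1 hyz
      have h0 := (isGraded_iff V N).1 hN 0 _ h
      rw [map_sub, V.proj_of_mem hy, V.proj_of_mem_of_ne (by decide) hz, zero_sub] at h0
      exact (Submodule.Quotient.mk_eq_zero N).2 (by simpa using h0)
    · rw [codisjoint_iff, Submodule.eq_top_iff']
      intro x
      obtain ⟨y, rfl⟩ := N.mkQ_surjective x
      refine Submodule.mem_sup.2 ⟨_, ⟨_, V.proj_mem 0 y, rfl⟩, _, ⟨_, V.proj_mem 1 y, rfl⟩, ?_⟩
      change N.mkQ _ + N.mkQ _ = _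
      rw [← map_add, V.proj_zero_add_proj_one]
  smul_mem := by
    rintro i j a _ ha ⟨x, hx, rfl⟩
    exact ⟨a • x, V.smul_mem ha hx, map_smul N.mkQ a x⟩

/-- The projection to the quotient by a graded submodule. -/
def quotientMap (V : SuperModule.{u, v, w} 𝒜) (N : Submodule A V.carrier) (hN : V.IsGraded N) :
    V.carrier →ₗ[A] (V.quotient N hN).carrier := N.mkQ

theorem quotientMap_surjective (V : SuperModule.{u, v, w} 𝒜) (N : Submodule A V.carrier)
    (hN : V.IsGraded N) : Function.Surjective (V.quotientMap N hN) := N.mkQ_surjective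

theorem quotientMap_eq_zero_iff (V : SuperModule.{u, v, w} 𝒜) (N : Submodule A V.carrier)
    (hN : V.IsGraded N) (x : V.carrier) : V.quotientMap N hN x = 0 ↔ x ∈ N :=
  Submodule.Quotient.mk_eq_zero N

theorem quotientMap_isHomogeneous (V : SuperModule.{u, v, w} 𝒜) (N : Submodule A V.carrier)
    (hN : V.IsGraded N) : IsHomogeneous V (V.quotient N hN) 0 (V.quotientMap N hN) :=
  fun i x hx => by rw [add_zero]; exact ⟨x, hx, rfl⟩

/-- Homogeneous maps factor through even surjections. -/
theorem exists_factor {V : SuperModule.{u, v, w₁} 𝒜} {W : SuperModule.{u, v, w₂} 𝒜}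
    {U : SuperModule.{u, v, w₃} 𝒜} {p : ZMod 2} {q : V.carrier →ₗ[A] W.carrier}
    (hq : IsHomogeneous V W 0 q) (hs : Function.Surjective q) {f : V.carrier →ₗ[A] U.carrier}
    (hf : IsHomogeneous V U p f) (hqf : LinearMap.ker q ≤ LinearMap.ker f) :
    ∃ g : W.carrier →ₗ[A] U.carrier, IsHomogeneous W U p g ∧ ∀ x, g (q x) = f x := by
  let g : W.carrier →ₗ[A] U.carrier :=
    (LinearMap.ker q).liftQ f hqf ∘ₗ (q.quotKerEquivOfSurjective hs).symm.toLinearMap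
  have hg : ∀ x, g (q x) = f x := fun x => by
    have : (q.quotKerEquivOfSurjective hs).symm (q x) = (LinearMap.ker q).mkQ x := by
      rw [LinearEquiv.symm_apply_eq]; rfl
    simp only [g, LinearMap.comp_apply, LinearEquiv.coe_coe, this]
    rfl
  refine ⟨g, fun i z hz => ?_, hg⟩
  obtain ⟨x, rfl⟩ := hs z
  have h := hq.map_proj i x
  rw [add_zero, W.proj_of_mem hz] at h
  rw [h, hg]
  exact hf _ _ (V.proj_mem i x)

theorem isCompl_of_gradedAlgebra (𝒜 : ZMod 2 → Submodule R A) [GradedAlgebra 𝒜] (j : ZMod 2) :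
    IsCompl (𝒜 j) (𝒜 (j + 1)) := by
  refine (DirectSum.Decomposition.isInternal 𝒜).isCompl (by simp) ?_
  ext i
  rcases two_eq_zero_or_one i with rfl | rfl <;> rcases two_eq_zero_or_one j with rfl | rfl <;>
    simp; decide

/-- The regular supermodule with its grading shifted by `j`. -/
def regular (𝒜 : ZMod 2 → Submodule R A) [GradedAlgebra 𝒜] (j : ZMod 2) :
    SuperModule.{u, v, max v w} 𝒜 where
  carrier := ULift.{w} A
  grading i := (𝒜 (i + j)).comap (ULift.moduleEquiv : ULift.{w} A ≃ₗ[R] A).toLinearMap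
  isInternal := isInternal_of_isCompl <| by
    have h := isCompl_of_gradedAlgebra 𝒜 (0 + j)
    have h1 : 0 + j + 1 = 1 + j := by abel
    rw [h1] at h
    exact (Submodule.orderIsoMapComap
      (ULift.moduleEquiv : ULift.{w} A ≃ₗ[R] A)).symm.isCompl_iff.1 h
  smul_mem := fun {i k a x} ha hx => by
    change a * x.down ∈ 𝒜 (i + k + j)
    rw [add_assoc]
    exact SetLike.mul_mem_graded ha hx

/-- The map is `b ↦ b x`. The shift by `j` puts the unit of the algebra in degree `j`, the degree of
`x`, which makes the map even. -/
theorem exists_surjective_of_regular (𝒜 : ZMod 2 → Submodule R A) [GradedAlgebra 𝒜]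
    {S : Type u'} [CommRing S] [Algebra R S]
    {X : SuperModule.{u', max u' v, w₃} fun i => (𝒜 i).baseChange S} {j : ZMod 2}
    {x : X.carrier} (hx : x ∈ X.grading j) (htop : Submodule.span (S ⊗[R] A) {x} = ⊤) :
    ∃ g : ((regular.{u, v, w} 𝒜 j).baseChange S).carrier →ₗ[S ⊗[R] A] X.carrier,
      IsHomogeneous ((regular.{u, v, w} 𝒜 j).baseChange S) X 0 g ∧ Function.Surjective g := by
  let θ : S ⊗[R] ULift.{w} A ≃ₗ[S] S ⊗[R] A :=
    (ULift.moduleEquiv : ULift.{w} A ≃ₗ[R] A).baseChange R S _ _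
  let g₀ : ((regular.{u, v, w} 𝒜 j).baseChange S).carrier →ₗ[S] X.carrier :=
    (LinearMap.toSpanSingleton (S ⊗[R] A) X.carrier x).restrictScalars S ∘ₗ θ.toLinearMap
  have hg₀ : ∀ y : ULift.{w} A, g₀ ((regular.{u, v, w} 𝒜 j).toBaseChange S y) =
      ((1 : S) ⊗ₜ[R] y.down : S ⊗[R] A) • x := fun y => rfl
  have hm : ∀ (a : A) (y : ULift.{w} A),
      g₀ ((regular.{u, v, w} 𝒜 j).toBaseChange S (a • y : ULift.{w} A)) =
        ((1 : S) ⊗ₜ[R] a : S ⊗[R] A) • g₀ ((regular.{u, v, w} 𝒜 j).toBaseChange S y) :=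
    fun a y => by
      rw [hg₀, hg₀, smul_smul, Algebra.TensorProduct.tmul_mul_tmul, one_mul]
      rfl
  refine ⟨extendLinear g₀ hm, isHomogeneous_of_toBaseChange fun i y hy => ?_, fun z => ?_⟩
  · rw [add_zero]
    change ((1 : S) ⊗ₜ[R] (ULift.down y) : S ⊗[R] A) • x ∈ X.grading i
    have h := X.smul_mem (Submodule.tmul_mem_baseChange_of_mem (1 : S) hy) hx
    rwa [parity_add_self_add] at h
  · obtain ⟨b, rfl⟩ := Submodule.mem_span_singleton.1 (show z ∈ Submodule.span (S ⊗[R] A) {x} by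
      rw [htop]; trivial)
    refine ⟨θ.symm b, ?_⟩
    change θ (θ.symm b) • x = b • x
    rw [θ.apply_symm_apply]

end Constructions

end SuperModule

namespace SuperModule

/-! ### Existence of lattices and of lattice subquotients -/

section Lattices

open IsLocalRing

variable {O : Type u} [CommRing O] {A : Type v} [Ring A] [Algebra O A]
  {𝒜 : ZMod 2 → Submodule O A} {F : Type u} [Field F] [Algebra O F]

/-- The elements of a supermodule whose image in the base change lies in a given submodule. -/
def contraction (L : SuperModule.{u, v, w} 𝒜)
    (N : Submodule (F ⊗[O] A) (L.baseChange F).carrier) : Submodule A L.carrier where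
  carrier := {x | L.toBaseChange F x ∈ N}
  zero_mem' := by rw [Set.mem_ofPred_eq, map_zero]; exact N.zero_mem
  add_mem' := fun {x y} hx hy => by
    rw [Set.mem_ofPred_eq, map_add]; exact N.add_mem hx hy
  smul_mem' := fun a x hx => by
    rw [Set.mem_ofPred_eq, toBaseChange_smul]; exact N.smul_mem _ hx

theorem mem_contraction {L : SuperModule.{u, v, w} 𝒜}
    {N : Submodule (F ⊗[O] A) (L.baseChange F).carrier} {x : L.carrier} :
    x ∈ L.contraction N ↔ L.toBaseChange F x ∈ N := Iff.rfl

theorem isGraded_contraction {L : SuperModule.{u, v, w} 𝒜}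
    {N : Submodule (F ⊗[O] A) (L.baseChange F).carrier} (hN : (L.baseChange F).IsGraded N) :
    L.IsGraded (L.contraction N) := by
  rw [isGraded_iff] at hN ⊢
  intro i x hx
  rw [mem_contraction, ← proj_toBaseChange]
  exact hN i _ hx

theorem finite_quotient {L : SuperModule.{u, v, w} 𝒜} [Module.Finite O L.carrier]
    (M : Submodule A L.carrier) (hM : L.IsGraded M) :
    Module.Finite O (L.quotient M hM).carrier :=
  Module.Finite.of_surjective ((L.quotientMap M hM).restrictScalars O)
    (L.quotientMap_surjective M hM)

theorem finite_ofSubmodule [IsNoetherianRing O] {L : SuperModule.{u, v, w} 𝒜}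
    [Module.Finite O L.carrier] (M : Submodule A L.carrier) (hM : L.IsGraded M) :
    Module.Finite O (L.ofSubmodule M hM).carrier :=
  show Module.Finite O (M.restrictScalars O) from inferInstance

theorem free_regular [GradedAlgebra 𝒜] [Module.Free O A] (j : ZMod 2) :
    Module.Free O (regular.{u, v, w} 𝒜 j).carrier :=
  show Module.Free O (ULift.{w} A) from inferInstance

theorem finite_regular [GradedAlgebra 𝒜] [Module.Finite O A] (j : ZMod 2) :
    Module.Finite O (regular.{u, v, w} 𝒜 j).carrier :=
  show Module.Finite O (ULift.{w} A) from inferInstance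

theorem smul_mem_iff_of_ne_zero {K : Type u} {B : Type v} [Field K] [Ring B] [Algebra K B]
    {ℬ : ZMod 2 → Submodule K B} {V : SuperModule.{u, v, w} ℬ} (N : Submodule B V.carrier) {s : K}
    (hs : s ≠ 0) {x : V.carrier} : s • x ∈ N ↔ x ∈ N :=
  ⟨fun h => by
    have := N.smul_of_tower_mem s⁻¹ h
    rwa [smul_smul, inv_mul_cancel₀ hs, one_smul] at this, N.smul_of_tower_mem s⟩

variable [IsDomain O] [IsFractionRing O F] {L : SuperModule.{u, v, w} 𝒜}
  {N : Submodule (F ⊗[O] A) (L.baseChange F).carrier}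

theorem exists_smul_eq_toBaseChange (y : (L.baseChange F).carrier) :
    ∃ s : F, s ≠ 0 ∧ ∃ x, s • y = L.toBaseChange F x := by
  obtain ⟨s, hs, h⟩ := exists_clear_denominators (F := F) L (fun _ : Unit => y)
  exact ⟨algebraMap O F s, by simpa using hs, h ()⟩

/-- As `N` is an `F`-subspace, `r x ∈ N` with `r ≠ 0` forces `x ∈ N`. Over a discrete valuation ring
this makes the quotient free, so that it is again a lattice. -/
theorem isTorsionFree_quotient_contraction (hN : (L.baseChange F).IsGraded N) :
    Module.IsTorsionFree O (L.quotient _ (isGraded_contraction hN)).carrier := by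
  refine ⟨fun r hr => ?_⟩
  have hr0 : r ≠ 0 := hr.ne_zero
  refine (isSMulRegular_iff_right_eq_zero_of_smul).2 fun z hz => ?_
  obtain ⟨x, rfl⟩ := L.quotientMap_surjective _ (isGraded_contraction hN) z
  rw [← map_smul_base, quotientMap_eq_zero_iff, mem_contraction, toBaseChange_smul_base,
    smul_mem_iff_of_ne_zero N (by simpa using hr0)] at hz
  rwa [quotientMap_eq_zero_iff]

variable [IsDiscreteValuationRing O] [Module.Finite O L.carrier]

theorem free_quotient_contraction (hN : (L.baseChange F).IsGraded N) :
    Module.Free O (L.quotient _ (isGraded_contraction hN)).carrier := by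
  have := isTorsionFree_quotient_contraction hN
  have := finite_quotient _ (isGraded_contraction hN)
  exact Module.free_of_finite_type_torsion_free'

theorem baseChangeMap_surjective {R : Type u} {A : Type v} [CommRing R] [Ring A] [Algebra R A]
    {𝒜 : ZMod 2 → Submodule R A} (S : Type u') [CommRing S] [Algebra R S]
    {V : SuperModule.{u, v, w₁} 𝒜} {W : SuperModule.{u, v, w₂} 𝒜}
    {f : V.carrier →ₗ[A] W.carrier} (hf : Function.Surjective f) :
    Function.Surjective (baseChangeMap S f) :=
  LinearMap.lTensor_surjective S (g := f.restrictScalars R) hf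

/-- A non-zero scalar moves any vector into the image of `L`. There, lying in `N` means vanishing in
the quotient, and the free quotient embeds in its generic fibre. -/
theorem ker_baseChangeMap_quotientMap_contraction (hN : (L.baseChange F).IsGraded N) :
    LinearMap.ker (baseChangeMap F (L.quotientMap _ (isGraded_contraction hN))) = N := by
  have := free_quotient_contraction hN
  ext y
  obtain ⟨s, hs, x, hx⟩ := exists_smul_eq_toBaseChange y
  rw [← smul_mem_iff_of_ne_zero N hs, hx, ← mem_contraction,
    ← quotientMap_eq_zero_iff _ _ (isGraded_contraction hN), LinearMap.mem_ker,
    ← smul_eq_zero_iff_right hs, ← map_smul_base, hx, baseChangeMap_toBaseChange]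
  exact (toBaseChange_injective _ (IsFractionRing.injective O F)).eq_iff' (map_zero _)

theorem free_ofSubmodule [Module.Free O L.carrier] (M : Submodule A L.carrier) (hM : L.IsGraded M) :
    Module.Free O (L.ofSubmodule M hM).carrier :=
  show Module.Free O (M.restrictScalars O) from inferInstance

/-- The image of a lattice in a quotient is a lattice. -/
theorem exists_lattice_of_surjective
    {V : SuperModule.{u, max u v, w₃} fun i => (𝒜 i).baseChange F}
    {g : (L.baseChange F).carrier →ₗ[F ⊗[O] A] V.carrier}
    (hg : IsHomogeneous (L.baseChange F) V 0 g) (hs : Function.Surjective g) :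
    ∃ Q : SuperModule.{u, v, w} 𝒜, Module.Free O Q.carrier ∧ Module.Finite O Q.carrier ∧
      IsoOfParity (Q.baseChange F) V 0 := by
  have hM := isGraded_contraction hg.isGraded_ker
  have hker := ker_baseChangeMap_quotientMap_contraction hg.isGraded_ker
  obtain ⟨e, he, heq⟩ := exists_factor ((L.quotientMap_isHomogeneous _ hM).baseChange (S := F))
    (baseChangeMap_surjective F (L.quotientMap_surjective _ hM)) hg hker.le
  refine ⟨L.quotient _ hM, free_quotient_contraction hg.isGraded_ker, finite_quotient _ hM,
    LinearEquiv.ofBijective e ⟨?_, ?_⟩, he⟩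
  · rw [← LinearMap.ker_eq_bot, Submodule.eq_bot_iff]
    intro z hz
    obtain ⟨y, rfl⟩ := baseChangeMap_surjective F (L.quotientMap_surjective _ hM) z
    rw [LinearMap.mem_ker, heq, ← LinearMap.mem_ker, ← hker] at hz
    exact hz
  · intro x
    obtain ⟨y, rfl⟩ := hs x
    exact ⟨_, heq y⟩

/-- Right exactness of the tensor product. -/
theorem ker_baseChangeMap_quotientMap_le {R : Type u} {A : Type v} [CommRing R] [Ring A]
    [Algebra R A] {𝒜 : ZMod 2 → Submodule R A} (S : Type u') [CommRing S] [Algebra R S]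
    {V : SuperModule.{u, v, w} 𝒜} (M : Submodule A V.carrier) (hM : V.IsGraded M) :
    LinearMap.ker (baseChangeMap S (V.quotientMap M hM)) ≤
      LinearMap.range (baseChangeMap S (V.inclusion M hM)) := by
  intro y hy
  have hex : Function.Exact ((V.inclusion M hM).restrictScalars R)
      ((V.quotientMap M hM).restrictScalars R) := fun x => by
    refine (V.quotientMap_eq_zero_iff M hM x).trans ⟨fun h => ⟨⟨x, h⟩, rfl⟩, ?_⟩
    rintro ⟨z, rfl⟩
    exact z.2
  exact ((lTensor_exact S hex (V.quotientMap_surjective M hM)) y).1 hy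

/-- A lattice whose reduction maps non-trivially to `W` has a subquotient of the same kind with
simple generic fibre. -/
theorem exists_simple_subquotient {p : ZMod 2} (n : ℕ) {L : SuperModule.{u, v, w} 𝒜}
    [Module.Free O L.carrier] [Module.Finite O L.carrier] (hn : Module.finrank O L.carrier ≤ n)
    {k : Type u} [Field k] [Algebra O k]
    {W : SuperModule.{u, max u v, w₃} fun i => (𝒜 i).baseChange k}
    {g : (L.baseChange k).carrier →ₗ[k ⊗[O] A] W.carrier}
    (hg : IsHomogeneous (L.baseChange k) W p g) (h0 : g ≠ 0) :
    ∃ Q : SuperModule.{u, v, w} 𝒜, Module.Free O Q.carrier ∧ Module.Finite O Q.carrier ∧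
      (Q.baseChange F).IsSimple ∧
      ∃ f : (Q.baseChange k).carrier →ₗ[k ⊗[O] A] W.carrier,
        IsHomogeneous (Q.baseChange k) W p f ∧ f ≠ 0 := by
  have hLn : Nontrivial L.carrier := by
    refine nontrivial_of_nontrivial_baseChange (S := k) ?_
    by_contra h
    rw [not_nontrivial_iff_subsingleton] at h
    exact h0 (LinearMap.ext fun x => by rw [Subsingleton.elim x 0, map_zero, map_zero])
  induction n generalizing L with
  | zero => exact absurd hn (by simpa using (Module.finrank_pos (R := O) (M := L.carrier)).ne')
  | succ n ih =>
    by_cases hs : (L.baseChange F).IsSimple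
    · exact ⟨L, inferInstance, inferInstance, hs, g, hg, h0⟩
    -- A proper non-zero graded `N` cuts `L` into the sublattice lying in `N` and the quotient by
    -- it. Both are non-zero and their ranks add up to that of `L`, so the induction applies to
    -- either.
    obtain ⟨N, hN, hbot, htop⟩ : ∃ N, (L.baseChange F).IsGraded N ∧ N ≠ ⊥ ∧ N ≠ ⊤ := by
      by_contra! h
      refine hs ⟨L.nontrivial_baseChange, fun N hN => ?_⟩
      by_cases hb : N = ⊥
      · exact Or.inl hb
      · exact Or.inr (h N hN hb)
    have hM := isGraded_contraction hN
    have := finite_quotient _ hM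
    have := free_quotient_contraction hN
    have := finite_ofSubmodule _ hM
    have := free_ofSubmodule _ hM
    have hMn : Nontrivial (L.ofSubmodule _ hM).carrier := by
      obtain ⟨y, hy, hy0⟩ := Submodule.exists_mem_ne_zero_of_ne_bot hbot
      obtain ⟨s, hs0, x, hx⟩ := exists_smul_eq_toBaseChange y
      refine ⟨⟨x, ?_⟩, 0, fun h => ?_⟩
      · rw [mem_contraction, ← hx]
        exact (smul_mem_iff_of_ne_zero N hs0).2 hy
      · have hx0 : x = 0 := congrArg Subtype.val h
        rw [hx0, map_zero] at hx
        exact (smul_ne_zero hs0 hy0) hx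
    have hQn : Nontrivial (L.quotient _ hM).carrier := by
      by_contra h
      rw [not_nontrivial_iff_subsingleton] at h
      refine htop ((Submodule.eq_top_iff').2 fun y => ?_)
      obtain ⟨s, hs0, x, hx⟩ := exists_smul_eq_toBaseChange y
      rw [← smul_mem_iff_of_ne_zero N hs0, hx, ← mem_contraction,
        ← quotientMap_eq_zero_iff _ _ hM]
      exact Subsingleton.elim _ _
    have hrank : Module.finrank O (L.quotient _ hM).carrier +
        Module.finrank O (L.ofSubmodule _ hM).carrier = Module.finrank O L.carrier := by
      have h1 := ((L.contraction N).restrictScalars O).finrank_quotient_add_finrank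
      exact h1
    have hMpos := Module.finrank_pos (R := O) (M := (L.ofSubmodule _ hM).carrier)
    have hQpos := Module.finrank_pos (R := O) (M := (L.quotient _ hM).carrier)
    -- If `g` kills the reduction of the sublattice it factors through that of the quotient;
    -- otherwise its restriction to the sublattice is the non-zero map sought.
    by_cases hgM : g ∘ₗ baseChangeMap k (L.inclusion _ hM) = 0
    · obtain ⟨f, hf, hfg⟩ := exists_factor
        ((L.quotientMap_isHomogeneous _ hM).baseChange (S := k))
        (baseChangeMap_surjective k (L.quotientMap_surjective _ hM)) hg fun y hy => by
          obtain ⟨z, rfl⟩ := ker_baseChangeMap_quotientMap_le k _ hM hy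
          exact LinearMap.congr_fun hgM z
      refine ih (by omega) hf (fun hf0 => h0 (LinearMap.ext fun y => ?_)) hQn
      rw [← hfg, hf0]; rfl
    · have hgM' := hg.comp ((L.inclusion_isHomogeneous _ hM).baseChange (S := k))
      rw [zero_add] at hgM'
      exact ih (by omega) hgM' hgM hMn

section Regular

variable [GradedAlgebra 𝒜] [Module.Free O A] [Module.Finite O A]

variable (𝒜) in
theorem IsSimple.exists_lattice {V : SuperModule.{u, max u v, w₃} fun i => (𝒜 i).baseChange F}
    (hV : V.IsSimple) : ∃ Q : SuperModule.{u, v, max v w} 𝒜, Module.Free O Q.carrier ∧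
      Module.Finite O Q.carrier ∧ IsoOfParity (Q.baseChange F) V 0 := by
  obtain ⟨j, x, hx, htop⟩ := hV.exists_generator ((Spans.of_gradedAlgebra 𝒜).baseChange F)
  obtain ⟨g, hg, hs⟩ := exists_surjective_of_regular.{u, v, w} 𝒜 hx htop
  have := free_regular.{u, v, w} (𝒜 := 𝒜) j
  have := finite_regular.{u, v, w} (𝒜 := 𝒜) j
  exact exists_lattice_of_surjective hg hs

variable (𝒜 F) in
theorem IsSimple.exists_lattice_of_residue {k : Type u} [Field k] [Algebra O k]
    {W : SuperModule.{u, max u v, w₃} fun i => (𝒜 i).baseChange k} (hW : W.IsSimple) :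
    ∃ Q : SuperModule.{u, v, max v w} 𝒜, Module.Free O Q.carrier ∧ Module.Finite O Q.carrier ∧
      (Q.baseChange F).IsSimple ∧
      ∃ p, ∃ f : (Q.baseChange k).carrier →ₗ[k ⊗[O] A] W.carrier,
        IsHomogeneous (Q.baseChange k) W p f ∧ f ≠ 0 := by
  obtain ⟨j, x, hx, htop⟩ := hW.exists_generator ((Spans.of_gradedAlgebra 𝒜).baseChange k)
  obtain ⟨g, hg, hs⟩ := exists_surjective_of_regular.{u, v, w} 𝒜 hx htop
  have := free_regular.{u, v, w} (𝒜 := 𝒜) j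
  have := finite_regular.{u, v, w} (𝒜 := 𝒜) j
  have hg0 : g ≠ 0 := by
    rintro rfl
    have := hW.1
    obtain ⟨y, hy⟩ := exists_ne (0 : W.carrier)
    obtain ⟨z, rfl⟩ := hs y
    exact hy rfl
  obtain ⟨Q, h1, h2, h3, h4⟩ := exists_simple_subquotient (F := F) _ le_rfl hg hg0
  exact ⟨Q, h1, h2, h3, 0, h4⟩

end Regular

end Lattices

end SuperModule

namespace SuperModule

/-! ### The bijection between isomorphism classes -/

section Main

open IsLocalRing

theorem isLattice_iff {O : Type u} [CommRing O] {A : Type v} [Ring A] [Algebra O A]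
    {𝒜 : ZMod 2 → Submodule O A} (hA : Spans 𝒜) {F : Type u'} [Field F] [Algebra O F]
    {L : SuperModule.{u, v, w₁} 𝒜}
    {V : SuperModule.{u', max u' v, w₂} fun i => (𝒜 i).baseChange F} :
    IsLattice L V ↔ Module.Free O L.carrier ∧ Module.Finite O L.carrier ∧
      IsoOfParity (L.baseChange F) V 0 := by
  rw [isoOfParity_iff (hA.baseChange F)]
  rfl

theorem IsSplit.hasScalarEvenEnds_baseChange {O : Type u} [CommRing O] {A : Type v} [Ring A]
    [Algebra O A] [Module.Finite O A] {𝒜 : ZMod 2 → Submodule O A} [GradedAlgebra 𝒜]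
    {K : Type u} [Field K] [Algebra O K]
    (hs : IsSplit fun i => (𝒜 i).baseChange K)
    {V : SuperModule.{u, max u v, max u v} fun i => (𝒜 i).baseChange K} (hV : V.IsSimple) :
    HasScalarEvenEnds V :=
  hs.hasScalarEvenEnds ((Spans.of_gradedAlgebra 𝒜).baseChange K) hV

variable {O : Type u} [CommRing O] [IsDomain O] [IsDiscreteValuationRing O]
  {F : Type u} [Field F] [Algebra O F] [IsFractionRing O F]
  {A : Type v} [Ring A] [Algebra O A] [Module.Finite O A]
  {𝒜 : ZMod 2 → Submodule O A} [GradedAlgebra 𝒜] [IsSemisimpleRing (ResidueField O ⊗[O] A)]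

theorem IsLattice.isSimple_residueField (hs : IsSplit fun i => (𝒜 i).baseChange F)
    {V : SuperModule.{u, max u v, max u v} fun i => (𝒜 i).baseChange F} (hV : V.IsSimple)
    {L : SuperModule.{u, v, max u v} 𝒜} (hL : IsLattice L V) :
    (L.baseChange (ResidueField O)).IsSimple := by
  obtain ⟨_, _, he⟩ := (isLattice_iff (Spans.of_gradedAlgebra 𝒜)).1 hL
  have h := he.symm.isSimple hV
  exact SuperModule.isSimple_residueField (Spans.of_gradedAlgebra 𝒜) h
    (hs.hasScalarEvenEnds_baseChange h)

theorem IsLattice.isoOfParity_residueField_iff (hs : IsSplit fun i => (𝒜 i).baseChange F)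
    {V V' : SuperModule.{u, max u v, max u v} fun i => (𝒜 i).baseChange F} (hV : V.IsSimple)
    (hV' : V'.IsSimple) {L L' : SuperModule.{u, v, max u v} 𝒜} (hL : IsLattice L V)
    (hL' : IsLattice L' V') {p : ZMod 2} :
    IsoOfParity (L.baseChange (ResidueField O)) (L'.baseChange (ResidueField O)) p ↔
      IsoOfParity V V' p := by
  obtain ⟨_, _, he⟩ := (isLattice_iff (Spans.of_gradedAlgebra 𝒜)).1 hL
  obtain ⟨_, _, he'⟩ := (isLattice_iff (Spans.of_gradedAlgebra 𝒜)).1 hL'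
  have h := he.symm.isSimple hV
  have h' := he'.symm.isSimple hV'
  rw [SuperModule.isoOfParity_residueField_iff (Spans.of_gradedAlgebra 𝒜) h
    (hs.hasScalarEvenEnds_baseChange h) h' (hs.hasScalarEvenEnds_baseChange h')]
  constructor
  · intro e
    have := (he.symm.trans e).trans he'
    rwa [zero_add, add_zero] at this
  · intro e
    have := (he.trans e).trans he'.symm
    rwa [zero_add, add_zero] at this

variable [Module.Free O A]

/-- Every simple supermodule over the residue algebra is the reduction of a lattice in a simple
supermodule. -/
theorem IsSimple.exists_isLattice_isoOfParity (hs : IsSplit fun i => (𝒜 i).baseChange F)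
    {W : SuperModule.{u, max u v, max u v} fun i => (𝒜 i).baseChange (ResidueField O)}
    (hW : W.IsSimple) :
    ∃ V : SuperModule.{u, max u v, max u v} fun i => (𝒜 i).baseChange F, V.IsSimple ∧
      ∃ L : SuperModule.{u, v, max u v} 𝒜, IsLattice L V ∧
        ∃ p, IsoOfParity (L.baseChange (ResidueField O)) W p := by
  obtain ⟨L, _, _, hL, p, f, hf, h0⟩ := hW.exists_lattice_of_residue.{u, v, u} 𝒜 F
  have hLat : IsLattice L (L.baseChange F) := ⟨inferInstance, inferInstance,
    LinearEquiv.refl F _, fun i x hx => by simpa using hx, fun i a _ x => by simp⟩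
  exact ⟨_, hL, L, hLat, p, hf.isoOfParity (hLat.isSimple_residueField hs hL) hW h0⟩

/-- Two reductions are isomorphic exactly when the generic fibres are: one implication makes the map
well defined, the other injective. -/
theorem exists_bijective_irr (hs : IsSplit fun i => (𝒜 i).baseChange F)
    (lat : ∀ V : SuperModule.{u, max u v, max u v} (fun i => (𝒜 i).baseChange F),
      V.IsSimple → SuperModule.{u, v, max u v} 𝒜)
    (hlat : ∀ V hV, IsLattice (lat V hV) V) :
    ∃ Φ : Irr.{u, max u v, max u v} (fun i => (𝒜 i).baseChange F) →
        Irr.{u, max u v, max u v} (fun i => (𝒜 i).baseChange (ResidueField O)),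
      Function.Bijective Φ ∧
      ∀ V (hV : V.IsSimple), ∃ h : ((lat V hV).baseChange (ResidueField O)).IsSimple,
        Φ hV.toIrr = h.toIrr := by
  have hA := Spans.of_gradedAlgebra 𝒜
  have hk : ∀ V hV, ((lat V hV).baseChange (ResidueField O)).IsSimple := fun V hV =>
    (hlat V hV).isSimple_residueField hs hV
  have hiso : ∀ V hV V' hV', IsIso ((lat V hV).baseChange (ResidueField O))
      ((lat V' hV').baseChange (ResidueField O)) ↔ IsIso V V' := fun V hV V' hV' => by
    rw [isIso_iff (hA.baseChange _), isIso_iff (hA.baseChange _)]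
    exact exists_congr fun p =>
      (hlat V hV).isoOfParity_residueField_iff hs hV hV' (hlat V' hV')
  refine ⟨Quotient.lift (fun V => (hk V.1 V.2).toIrr) fun V V' h =>
    Quotient.sound ((hiso V.1 V.2 V'.1 V'.2).2 h), ⟨?_, ?_⟩, fun V hV => ⟨hk V hV, rfl⟩⟩
  · intro x y
    refine Quotient.inductionOn₂ x y fun V V' h => ?_
    exact Quotient.sound ((hiso V.1 V.2 V'.1 V'.2).1 (Quotient.exact h))
  · intro y
    refine Quotient.inductionOn y fun W => ?_
    obtain ⟨V, hV, L, hL, p, hp⟩ := W.2.exists_isLattice_isoOfParity hs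
    refine ⟨hV.toIrr, Quotient.sound ((isIso_iff (hA.baseChange _)).2 ⟨p, ?_⟩)⟩
    -- The lattice `L` that reduces to `W` may differ from the chosen one. Comparing the two
    -- lattices along the identity of `V` shows that their reductions are isomorphic.
    have h0 : IsoOfParity V V 0 := ⟨LinearEquiv.refl _ _, fun i x hx => by simpa using hx⟩
    have := (((hlat V hV).isoOfParity_residueField_iff hs hV hV hL).2 h0).trans hp
    rwa [zero_add] at this

end Main

end SuperModule

end

theorem theorem2p20
    {O : Type u} [CommRing O] [IsDomain O] [IsDiscreteValuationRing O]
    (h2 : (2 : IsLocalRing.ResidueField O) ≠ 0)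
    {F : Type u} [Field F] [Algebra O F] [IsFractionRing O F]
    {A : Type v} [Ring A] [Algebra O A] [Module.Free O A] [Module.Finite O A]
    (𝒜 : ZMod 2 → Submodule O A) [GradedAlgebra 𝒜]
    (hsplitF : SuperModule.IsSplit (fun i => (𝒜 i).baseChange F))
    (hsplitk : SuperModule.IsSplit (fun i => (𝒜 i).baseChange (IsLocalRing.ResidueField O)))
    (hss : Ring.jacobson (IsLocalRing.ResidueField O ⊗[O] A) = ⊥) :
    -- every simple supermodule over `F ⊗ A` has a graded lattice
    (∀ V : SuperModule.{u, max u v, max u v} (fun i => (𝒜 i).baseChange F), V.IsSimple →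
      ∃ L : SuperModule.{u, v, max u v} 𝒜, SuperModule.IsLattice L V) ∧
    -- and, for every choice of such lattices:
    ∀ (lat : ∀ V : SuperModule.{u, max u v, max u v} (fun i => (𝒜 i).baseChange F),
        V.IsSimple → SuperModule.{u, v, max u v} 𝒜),
      (∀ V hV, SuperModule.IsLattice (lat V hV) V) →
      ((∀ V : SuperModule.{u, max u v, max u v} (fun i => (𝒜 i).baseChange F),
          V.IsSimple → V.IsTypeM) →
        (∃ Φ : SuperModule.Irr.{u, max u v, max u v} (fun i => (𝒜 i).baseChange F) →
            SuperModule.Irr.{u, max u v, max u v}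
              (fun i => (𝒜 i).baseChange (IsLocalRing.ResidueField O)),
          Function.Bijective Φ ∧
          ∀ V (hV : V.IsSimple),
            ∃ h : ((lat V hV).baseChange (IsLocalRing.ResidueField O)).IsSimple,
              Φ hV.toIrr = h.toIrr) ∧
        ∀ W : SuperModule.{u, max u v, max u v}
            (fun i => (𝒜 i).baseChange (IsLocalRing.ResidueField O)),
          W.IsSimple → W.IsTypeM) ∧
      (IsAdicComplete (IsLocalRing.maximalIdeal O) O →
        ∃ Φ : SuperModule.Irr.{u, max u v, max u v} (fun i => (𝒜 i).baseChange F) →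
            SuperModule.Irr.{u, max u v, max u v}
              (fun i => (𝒜 i).baseChange (IsLocalRing.ResidueField O)),
          Function.Bijective Φ ∧
          ∀ V (hV : V.IsSimple),
            (∃ h : ((lat V hV).baseChange (IsLocalRing.ResidueField O)).IsSimple,
              Φ hV.toIrr = h.toIrr) ∧
            (V.IsTypeM → ((lat V hV).baseChange (IsLocalRing.ResidueField O)).IsTypeM) ∧
            (V.IsTypeQ → ((lat V hV).baseChange (IsLocalRing.ResidueField O)).IsTypeQ)) := by
  have hA := SuperModule.Spans.of_gradedAlgebra 𝒜
  have : IsArtinianRing (IsLocalRing.ResidueField O ⊗[O] A) :=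
    IsArtinianRing.of_finite (IsLocalRing.ResidueField O) _
  have : IsSemisimpleRing (IsLocalRing.ResidueField O ⊗[O] A) :=
    IsArtinianRing.isSemisimpleRing_iff_jacobson.2 hss
  refine ⟨fun V hV => ?_, fun lat hlat => ⟨fun hM => ⟨?_, fun W hW => ?_⟩, fun _ => ?_⟩⟩
  · obtain ⟨L, hL⟩ := hV.exists_lattice.{u, v, u} 𝒜
    exact ⟨L, (SuperModule.isLattice_iff hA).2 hL⟩
  · exact SuperModule.exists_bijective_irr hsplitF lat hlat
  · obtain ⟨V, hV, L, hL, p, hp⟩ := hW.exists_isLattice_isoOfParity hsplitF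
    rw [SuperModule.isTypeM_iff (hA.baseChange _) hW (hsplitk.hasScalarEvenEnds_baseChange hW)]
    intro h
    -- An odd automorphism of `W`, conjugated by an isomorphism of degree `p`, has degree `p + 1 + p
    -- = 1`. It gives an odd automorphism of the reduction of `L`, hence one of `V`, against type
    -- `M`.
    have h1 := (hp.trans h).trans hp.symm
    rw [add_right_comm, add_comm, ← add_assoc, SuperModule.parity_add_self_add] at h1
    exact (SuperModule.isTypeM_iff (hA.baseChange _) hV
      (hsplitF.hasScalarEvenEnds_baseChange hV)).1 (hM V hV)
      ((hL.isoOfParity_residueField_iff hsplitF hV hV hL).1 h1)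
  · obtain ⟨Φ, hΦ, h⟩ := SuperModule.exists_bijective_irr hsplitF lat hlat
    refine ⟨Φ, hΦ, fun V hV => ⟨h V hV, ?_⟩⟩
    have hk := (hlat V hV).isSimple_residueField hsplitF hV
    -- On both sides the type records whether an odd automorphism exists, and the comparison of a
    -- lattice with itself in degree `1` matches the two conditions.
    rw [SuperModule.isTypeM_iff (hA.baseChange _) hk (hsplitk.hasScalarEvenEnds_baseChange hk),
      SuperModule.isTypeQ_iff (hA.baseChange _) hk (hsplitk.hasScalarEvenEnds_baseChange hk),
      (hlat V hV).isoOfParity_residueField_iff hsplitF hV hV (hlat V hV),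
      SuperModule.isTypeM_iff (hA.baseChange _) hV (hsplitF.hasScalarEvenEnds_baseChange hV),
      SuperModule.isTypeQ_iff (hA.baseChange _) hV (hsplitF.hasScalarEvenEnds_baseChange hV)]
    exact ⟨id, id⟩
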